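/- Let $d\ge 1$ be an integer, and let $h,a,A$ be reals with $0<h<1$ and $0<a\le 1\le A<\infty$. Let $\lambda_d$ be Lebesgue measure on $[0,1]^d$ and let $\pi$ be a probability measure on $[0,1]^d\times\{-1,1\}$, with $(X,Y)\sim\pi$, marginal $P^X$, and $\eta(x)=\mathbb P(Y=1\mid X=x)$. Write $R(f)=\mathbb P(f(X)\ne Y)$ and let $f^*=\operatorname{sign}(2\eta-1)$ be the Bayes rule. A classifier $\hat f_n$ associates to each sample $D_n=((X_i,Y_i))_{i\le n}$ of i.i.d. variables of law $\pi$ a rule $[0,1]^d\to\{-1,1\}$ (measurably in $(D_n,x)$); its excess risk is $\mathcal E_\pi(\hat f_n)=\mathbb E_\pi[R(\hat f_n)-R(f^*)]$. For $j\in\mathbb N$ and $\mathbf k\in I_d(j)=\{0,\dots,2^j-1\}^d$ let $\mathcal I^{(j)}_{\mathbf k}=\prod_i I^{(j)}_{k_i}$, where $I^{(j)}_k=[k2^{-j},(k+1)2^{-j})$, closed on the right if $k=2^j-1$, and let $\phi^{(j)}_{\mathbf k}$ be its indicator. For $w:\mathbb N\to[0,\infty)$, $\mathcal F^{(d)}_w$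 is the class of the rules $f$ which can be written $f=\sum_{j}\sum_{\mathbf k\in I_d(j)}a^{(j)}_{\mathbf k}\phi^{(j)}_{\mathbf k}$, $P^X$-a.s., with $a^{(j)}_{\mathbf k}\in\{-1,0,1\}$, $\operatorname{card}\{\mathbf k\in I_d(j):a^{(j)}_{\mathbf k}\neq0\}\le w(j)$ for all $j$, and the following writing convention: if $a^{(j)}_{\mathbf k}\ne 0$, then all coefficients of dyadic cells of higher frequency inside $\mathcal I^{(j)}_{\mathbf k}$ are $0$; and, for every cell, the non-zero coefficients of cells of higher frequency inside it are neither all equal to $1$ nor all equal to $-1$, unless there are none. Let $\mathcal P_{w,h,a,A}$ be the set of all $\pi$ such that $P^X\ll\lambda_d$ with $a\le dP^X/d\lambda_d\le A$ a.e. on $[0,1]^d$, $\mathbb P(|2\eta(X)-1|>h)=1$, and $f^*\in\mathcal F_w^{(d)}$. For an integer $K\ge1$ let $\mathcal P_K^{(d)}=\mathcal P_{w,h,a,A}$ with $w(j)=2^{dj}$ for $j\le K$ and $w(j)=2^{dK}$ for $j>K$ (truncated class). For $0<\alpha<1$ let $\mathcal P_\alpha^{(d)}=\mathcal P_{w,h,a,A}$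 with $w(j)=2^{dj}$ for $j\le N$ and $w(j)=2^{d\alpha j}$ for $j>N$, where $N=\min\{m\in\mathbb N:2^{d\alpha m}\ge 2^d-1\}$ (exponential class). For $J\in\mathbb N$, let $\hat f_n^{(J)}=\sum_{\mathbf k\in I_d(J)}\hat A_{\mathbf k}\phi_{\mathbf k}^{(J)}$ be the dyadic majority-vote classifier, where $\hat A_{\mathbf k}=1$ if strictly more of the observations with $X_i\in\mathcal I_{\mathbf k}^{(J)}$ have $Y_i=1$ than $Y_i=-1$, and $\hat A_{\mathbf k}=-1$ otherwise. Put $L_n=\lceil\log(an/(2^d\log n))/(d\log2)\rceil$. We say that $(J_n)$ is of order $L_n$ up to a multiplying constant if $c\,|L_n|\le J_n\le c'\,|L_n|$ for all large $n$, with constants $c,c'>0$, and moreover $|J_n-L_n|$ is bounded over $n\ge2$ (that is, $2^{dJ_n}$ and $an/(2^d\log n)$ agree up to constant factors). **Truncated class.** There are a sequence $(J_n)$ of non-negative integers, of order $L_n$ up to a multiplying constant, and a constant $C>0$, all depending only on $d,K,h,a,A$, such that for all $n\ge2$ $$\sup_{\pi\in\mathcal P_K^{(d)}}\mathcal E_\pi(\hat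 f_n^{(J_n)})\le C\,\frac{\log n}{n};$$ and there is $C_0>0$, depending only on $K,h,a,A$ (not on $d$), such that for all $n\ge1$ $$\inf_{\hat f_n}\sup_{\pi\in\mathcal P_K^{(d)}}\mathcal E_\pi(\hat f_n)\ge C_0\,n^{-1},$$ the infimum being over all classifiers. **Exponential class.** There are a sequence $(J_n)$ of non-negative integers, of order $L_n$ up to a multiplying constant, and constants $C',C_0'>0$, all depending only on $d,\alpha,h,a,A$, such that $$\sup_{\pi\in\mathcal P_\alpha^{(d)}}\mathcal E_\pi(\hat f_n^{(J_n)})\le C'\Big(\frac{\log n}{n}\Big)^{1-\alpha}\quad(n\ge2),\qquad \inf_{\hat f_n}\sup_{\pi\in\mathcal P_\alpha^{(d)}}\mathcal E_\pi(\hat f_n)\ge C_0'\,n^{-1+\alpha}\quad(n\ge1).$$ -/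

import Mathlib

open MeasureTheory ProbabilityTheory Filter Asymptotics
open scoped ENNReal unitInterval

namespace DyadicClassification

/-- The cube `[0,1]^d`, with its product σ-algebra; its `volume` is Lebesgue measure. -/
abbrev Cube (d : ℕ) : Type := Fin d → I

/-- The label set `{-1, 1}`. -/
abbrev Label : Type := ℤˣ

instance : DiscreteMeasurableSpace Label where
  forall_measurableSet s :=
    ⟨Units.val '' s, MeasurableSet.of_discrete,
      Set.preimage_image_eq s Units.val_injective⟩

/-! ### Prediction rules, risk, Bayes rule -/

/-- Misclassification error `R(f) = ℙ(f(X) ≠ Y)`. -/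
noncomputable def risk {d : ℕ} (π : ProbabilityMeasure (Cube d × Label)) (f : Cube d → Label) :
    ℝ :=
  (π : Measure (Cube d × Label)).real {z | f z.1 ≠ z.2}

/-- The marginal `P^X`. -/
noncomputable def marginal {d : ℕ} (π : ProbabilityMeasure (Cube d × Label)) :
    Measure (Cube d) :=
  (π : Measure (Cube d × Label)).fst

/-- The conditional probability function `η(x) = ℙ(Y = 1 | X = x)`. -/
noncomputable def eta {d : ℕ} (π : ProbabilityMeasure (Cube d × Label)) (x : Cube d) : ℝ :=
  ((π : Measure (Cube d × Label)).condKernel x).real {1}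

open Classical in
/-- The Bayes rule `f* = sign(2η - 1)`. -/
noncomputable def bayesRule {d : ℕ} (π : ProbabilityMeasure (Cube d × Label)) (x : Cube d) :
    Label :=
  if 0 ≤ 2 * eta π x - 1 then 1 else -1

/-- A classifier based on `n` observations: a (jointly measurable) map which associates a
prediction rule to every sample. -/
structure Classifier (d n : ℕ) where
  toFun : (Fin n → Cube d × Label) → Cube d → Label
  measurable' : Measurable (Function.uncurry toFun)

/-- The excess risk `E_π[R(f̂_n) - R(f*)]`, the sample being i.i.d. with law `π`. -/
noncomputable def excessRisk {d n : ℕ} (π : ProbabilityMeasure (Cube d × Label))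
    (f : Classifier d n) : ℝ :=
  ∫ D, (risk π (f.toFun D) - risk π (bayesRule π))
    ∂(Measure.pi fun _ : Fin n => (π : Measure (Cube d × Label)))

/-! ### Dyadic cells and the majority-vote classifier -/

/-- The interval `[k/2^j, (k+1)/2^j)`, closed on the right when `k = 2^j - 1`. -/
def dyadicInterval (j : ℕ) (k : Fin (2 ^ j)) : Set I :=
  {x | (k : ℝ) / 2 ^ j ≤ x ∧ ((x : ℝ) < ((k : ℝ) + 1) / 2 ^ j ∨ (k : ℕ) = 2 ^ j - 1)}

/-- The dyadic cell of frequency `j` and multi-index `k ∈ {0, …, 2^j - 1}^d`. -/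
def dyadicCell {d : ℕ} (j : ℕ) (k : Fin d → Fin (2 ^ j)) : Set (Cube d) :=
  {x | ∀ i, x i ∈ dyadicInterval j (k i)}

open Classical in
/-- Number of observations in the cell with label `y`. -/
noncomputable def cellCount {d n : ℕ} (J : ℕ) (k : Fin d → Fin (2 ^ J)) (y : Label)
    (D : Fin n → Cube d × Label) : ℕ :=
  (Finset.univ.filter fun i => (D i).1 ∈ dyadicCell J k ∧ (D i).2 = y).card

open Classical in
/-- The majority vote in a cell: `1` if the cell has strictly more observations labelled `1` than
labelled `-1` (so it contains an observation), and `-1` otherwise. -/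
noncomputable def majorityCoeff {d n : ℕ} (J : ℕ) (D : Fin n → Cube d × Label)
    (k : Fin d → Fin (2 ^ J)) : Label :=
  if cellCount J k (-1) D < cellCount J k 1 D then 1 else -1

open Classical in
/-- The rule equal to `majorityCoeff J D k` on the cell of index `k`; see
`majorityRule_eq_sum`. -/
noncomputable def majorityRule {d n : ℕ} (J : ℕ) (D : Fin n → Cube d × Label) (x : Cube d) :
    Label :=
  if ∃ k, x ∈ dyadicCell J k ∧ majorityCoeff J D k = 1 then 1 else -1

theorem dyadicInterval_existsUnique (j : ℕ) (x : I) : ∃! k, x ∈ dyadicInterval j k := by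
  have hp : (0 : ℝ) < 2 ^ j := by positivity
  have hpn : 0 < 2 ^ j := by positivity
  have hx0 : (0 : ℝ) ≤ x := x.2.1
  have hx1 : (x : ℝ) ≤ 1 := x.2.2
  have hy0 : (0 : ℝ) ≤ x * 2 ^ j := by positivity
  have key : ∀ k : Fin (2 ^ j), x ∈ dyadicInterval j k ↔
      (k : ℕ) = min ⌊(x : ℝ) * 2 ^ j⌋₊ (2 ^ j - 1) := by
    intro k
    have hk := k.2
    have hfl : ∀ m : ℕ, m ≤ ⌊(x : ℝ) * 2 ^ j⌋₊ ↔ (m : ℝ) ≤ x * 2 ^ j :=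
      fun m => Nat.le_floor_iff hy0
    have h1 : ((k : ℝ) / 2 ^ j ≤ x) ↔ (k : ℕ) ≤ ⌊(x : ℝ) * 2 ^ j⌋₊ := by
      rw [hfl, div_le_iff₀ hp]
    have h2 : ((x : ℝ) < ((k : ℝ) + 1) / 2 ^ j) ↔ ⌊(x : ℝ) * 2 ^ j⌋₊ < (k : ℕ) + 1 := by
      rw [lt_div_iff₀ hp, Nat.floor_lt hy0]; push_cast; rfl
    simp only [dyadicInterval, Set.mem_ofPred_eq, h1, h2]
    omega
  refine ⟨⟨min ⌊(x : ℝ) * 2 ^ j⌋₊ (2 ^ j - 1), by omega⟩, (key _).2 rfl, fun k hk => ?_⟩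
  exact Fin.ext ((key k).1 hk)

theorem dyadicCell_existsUnique {d : ℕ} (j : ℕ) (x : Cube d) : ∃! k, x ∈ dyadicCell j k := by
  choose k hk huniq using fun i => dyadicInterval_existsUnique j (x i)
  exact ⟨k, hk, fun k' hk' => funext fun i => huniq i _ (hk' i)⟩

/-- The majority rule is `∑_k Â_k φ_k`, with `φ_k` the indicator of the cell of index `k`. -/
theorem majorityRule_eq_sum {d n : ℕ} (J : ℕ) (D : Fin n → Cube d × Label) (x : Cube d) :
    ((majorityRule J D x : Label) : ℤ) =
      ∑ k, ((majorityCoeff J D k : Label) : ℤ) * (dyadicCell J k).indicator 1 x := by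
  classical
  obtain ⟨k₀, hk₀, huniq⟩ := dyadicCell_existsUnique J x
  rw [Finset.sum_eq_single k₀]
  · have : (∃ k, x ∈ dyadicCell J k ∧ majorityCoeff J D k = 1) ↔ majorityCoeff J D k₀ = 1 :=
      ⟨fun ⟨k, hk, h⟩ => huniq k hk ▸ h, fun h => ⟨k₀, hk₀, h⟩⟩
    rw [majorityRule, Set.indicator_of_mem hk₀]
    simp only [this]
    by_cases h : majorityCoeff J D k₀ = 1
    · simp [h]
    · have : majorityCoeff J D k₀ = -1 := (Int.units_eq_one_or _).resolve_left h
      simp [this]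
  · intro k _ hk
    rw [Set.indicator_of_notMem (fun h => hk (huniq k h)), mul_zero]
  · simp

theorem measurableSet_dyadicCell {d : ℕ} (j : ℕ) (k : Fin d → Fin (2 ^ j)) :
    MeasurableSet (dyadicCell j k) := by
  have h : ∀ k : Fin (2 ^ j), MeasurableSet (dyadicInterval j k) := by
    intro k
    have hc : Measurable fun x : I => (x : ℝ) := measurable_subtype_coe
    exact (measurableSet_le measurable_const hc).inter
      ((measurableSet_lt hc measurable_const).union (MeasurableSet.const _))
  have : dyadicCell j k = ⋂ i, (fun x : Cube d => x i) ⁻¹' dyadicInterval j (k i) := by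
    ext x; simp [dyadicCell]
  rw [this]
  exact MeasurableSet.iInter fun i => measurable_pi_apply i (h _)

theorem measurable_cellCount {d n : ℕ} (J : ℕ) (k : Fin d → Fin (2 ^ J)) (y : Label) :
    Measurable (cellCount (n := n) J k y) := by
  classical
  have : cellCount (n := n) J k y = fun D => ∑ i : Fin n,
      if (D i).1 ∈ dyadicCell J k ∧ (D i).2 = y then 1 else 0 := by
    funext D
    rw [cellCount, Finset.card_filter]
  rw [this]
  refine Finset.measurable_sum _ fun i _ => Measurable.ite ?_ measurable_const measurable_const
  have hi : Measurable fun D : Fin n → Cube d × Label => D i := measurable_pi_apply i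
  exact (hi.fst (measurableSet_dyadicCell J k)).inter (hi.snd (measurableSet_singleton y))

theorem measurable_majorityRule {d n : ℕ} (J : ℕ) :
    Measurable (Function.uncurry (majorityRule (d := d) (n := n) J)) := by
  classical
  have hs : MeasurableSet {p : (Fin n → Cube d × Label) × Cube d |
      ∃ k, p.2 ∈ dyadicCell J k ∧ majorityCoeff J p.1 k = 1} := by
    have : {p : (Fin n → Cube d × Label) × Cube d |
        ∃ k, p.2 ∈ dyadicCell J k ∧ majorityCoeff J p.1 k = 1} =
        ⋃ k, {p | p.2 ∈ dyadicCell J k} ∩ {p | cellCount J k (-1) p.1 < cellCount J k 1 p.1} := by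
      ext p
      simp only [majorityCoeff, Set.mem_ofPred_eq, Set.mem_iUnion, Set.mem_inter_iff]
      refine exists_congr fun k => and_congr_right fun _ => ?_
      split_ifs with h
      · simp [h]
      · simp only [h, iff_false]; decide
    rw [this]
    exact MeasurableSet.iUnion fun k => (measurable_snd (measurableSet_dyadicCell J k)).inter
      (measurableSet_lt ((measurable_cellCount J k _).comp measurable_fst)
        ((measurable_cellCount J k _).comp measurable_fst))
  have : Function.uncurry (majorityRule (d := d) (n := n) J) = fun p =>
      if p ∈ {p : (Fin n → Cube d × Label) × Cube d |
        ∃ k, p.2 ∈ dyadicCell J k ∧ majorityCoeff J p.1 k = 1} then 1 else -1 := by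
    funext p
    simp only [Function.uncurry, majorityRule, Set.mem_ofPred_eq]
  rw [this]
  exact Measurable.ite hs measurable_const measurable_const

/-- The dyadic majority-vote classifier `f̂_n^{(J)}` at frequency rank `J`. -/
noncomputable def majorityClassifier (d n J : ℕ) : Classifier d n where
  toFun := majorityRule J
  measurable' := measurable_majorityRule J

/-! ### Sparse classes of prediction rules -/

/-- Families of coefficients `a_k^{(j)} ∈ {-1, 0, 1}`. -/
abbrev Coeffs (d : ℕ) : Type := (j : ℕ) → (Fin d → Fin (2 ^ j)) → SignType

/-- The cell `(j', k')` is strictly finer than `(j, k)` and meets it (hence lies inside it). -/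
def Below {d : ℕ} {j j' : ℕ} (k : Fin d → Fin (2 ^ j)) (k' : Fin d → Fin (2 ^ j')) : Prop :=
  j < j' ∧ (dyadicCell j k ∩ dyadicCell j' k').Nonempty

/-- The writing convention (W): nothing non-zero lies below a non-zero coefficient, and the
non-zero coefficients below a knot of the tree are not all `1`, nor all `-1` (otherwise this value
is to be put at the knot itself). -/
structure WritingConvention {d : ℕ} (c : Coeffs d) : Prop where
  zero_below : ∀ j j' (k : Fin d → Fin (2 ^ j)) (k' : Fin d → Fin (2 ^ j')),
    Below k k' → c j k ≠ 0 → c j' k' = 0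
  not_constant_below : ∀ j (k : Fin d → Fin (2 ^ j)),
    (∃ (j' : ℕ) (k' : Fin d → Fin (2 ^ j')), Below k k' ∧ c j' k' ≠ 0) →
      (∃ (j' : ℕ) (k' : Fin d → Fin (2 ^ j')), Below k k' ∧ c j' k' = 1) ∧
      (∃ (j' : ℕ) (k' : Fin d → Fin (2 ^ j')), Below k k' ∧ c j' k' = -1)

/-- The value at `x` of `∑_j ∑_k c_k^{(j)} φ_k^{(j)}`. Under the writing convention, the sum over
`j` has at most one non-zero term. -/
noncomputable def dyadicSum {d : ℕ} (c : Coeffs d) (x : Cube d) : ℤ :=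
  ∑ᶠ j : ℕ, ∑ k : Fin d → Fin (2 ^ j), (c j k : ℤ) * (dyadicCell j k).indicator 1 x

/-- The class `F_w^{(d)}` of prediction rules (defined `P`-almost surely). -/
def sparseClass {d : ℕ} (w : ℕ → ℝ) (P : Measure (Cube d)) : Set (Cube d → Label) :=
  {f | ∃ c : Coeffs d, WritingConvention c ∧
    (∀ j, (Nat.card {k : Fin d → Fin (2 ^ j) // c j k ≠ 0} : ℝ) ≤ w j) ∧
    ∀ᵐ x ∂P, ((f x : Label) : ℤ) = dyadicSum c x}

/-- The weight of the truncated class of level `K`. -/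
noncomputable def truncatedWeight (d K : ℕ) (j : ℕ) : ℝ :=
  if j ≤ K then 2 ^ (d * j) else 2 ^ (d * K)

/-- `N^{(d)}(α) = inf {N ∈ ℕ : 2^{dαN} ≥ 2^d - 1}`. -/
noncomputable def expThreshold (d : ℕ) (α : ℝ) : ℕ :=
  sInf {N : ℕ | (2 : ℝ) ^ d - 1 ≤ (2 : ℝ) ^ ((d : ℝ) * α * N)}

/-- The weight of the exponential class of parameter `α`. -/
noncomputable def expWeight (d : ℕ) (α : ℝ) (j : ℕ) : ℝ :=
  if j ≤ expThreshold d α then 2 ^ (d * j) else (2 : ℝ) ^ ((d : ℝ) * α * j)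

/-! ### Statistical models and the rank -/

/-- (A1): `P` has a Lebesgue density with values in `[a, A]`. -/
def DensityAssumption {d : ℕ} (a A : ℝ) (P : Measure (Cube d)) : Prop :=
  P ≪ volume ∧ ∀ᵐ x ∂(volume : Measure (Cube d)),
    ENNReal.ofReal a ≤ P.rnDeriv volume x ∧ P.rnDeriv volume x ≤ ENNReal.ofReal A

/-- (SMA): `|2η(X) - 1| > h` almost surely. -/
def StrongMargin {d : ℕ} (h : ℝ) (π : ProbabilityMeasure (Cube d × Label)) : Prop :=
  ∀ᵐ x ∂(marginal π), h < |2 * eta π x - 1|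

/-- The model `𝒫_{w,h,a,A}`. -/
def model (d : ℕ) (w : ℕ → ℝ) (h a A : ℝ) : Set (ProbabilityMeasure (Cube d × Label)) :=
  {π | DensityAssumption a A (marginal π) ∧ StrongMargin h π ∧
    bayesRule π ∈ sparseClass w (marginal π)}

/-- The worst-case excess risk of a classifier over a set of distributions. -/
noncomputable def worstRisk {d n : ℕ} (Q : Set (ProbabilityMeasure (Cube d × Label)))
    (f : Classifier d n) : EReal :=
  ⨆ π ∈ Q, (excessRisk π f : EReal)

/-- The minimax excess risk over all classifiers based on `n` observations. -/
noncomputable def minimaxExcessRisk (d n : ℕ) (Q : Set (ProbabilityMeasure (Cube d × Label))) : EReal :=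
  ⨅ f : Classifier d n, worstRisk Q f

/-- `⌈log(a n / (2^d log n)) / (d log 2)⌉`. -/
noncomputable def referenceRank (d : ℕ) (a : ℝ) (n : ℕ) : ℤ :=
  ⌈Real.log (a * n / (2 ^ d * Real.log n)) / (d * Real.log 2)⌉

/-- `J_n` is of the order of `referenceRank d a n`, up to a multiplying constant: the two sequences
are of the same order, and moreover differ by a bounded amount, that is `2^{d J_n}` and
`a n / (2^d log n)` are equal up to a multiplying constant. -/
def HasReferenceOrder (d : ℕ) (a : ℝ) (J : ℕ → ℕ) : Prop :=
  ((fun n => (J n : ℝ)) =Θ[atTop] fun n => (referenceRank d a n : ℝ)) ∧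
    ∃ M : ℝ, ∀ n : ℕ, 2 ≤ n → |(J n : ℝ) - referenceRank d a n| ≤ M

end DyadicClassification

open DyadicClassification

namespace DyadicClassification

/-! Upper bounds. On a cell of frequency `J` where the Bayes rule is almost surely constant, the
margin biases every vote by at least `h`. A Chernoff bound then shows that the vote errs with
probability at most `exp(-h² n P(cell) / 2)`, where `P(cell) ≥ a 2^(-dJ)`
(`excessRisk_majorityClassifier_le`). Almost every remaining point lies in a cell of some frequency
`j ≥ J` carrying a non-zero coefficient. There are at most `w j ≤ W 2^(dαj)` of these, each of mass
at most `A 2^(-dj)`, and the geometric series sums to order `2^(-dJ(1-α))`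
(`measureReal_not_bayesConstant_le`). The truncated class is the case `α = 0`. Choosing `2^(dJ)` of
order `a n / log n` with a small enough constant balances the two terms (`exists_rank`).

Lower bounds. Let `X` be uniform and let `Y = f(X)` with probability `p`, where `2p - 1 > h`. The
labels of `f` are free on the cells of frequency `J` inside the corner cell of frequency `i₀`, one
of them excepted, and `f = -1` elsewhere. When `2^(dJ) ≥ 2n`, a given cell contains no observation
with probability at least `1/2`, and its label can then only be guessed (`two_point_lower_bound`).
Averaging over the labels gives an excess risk of order `2^(-d i₀)`, the volume of the corner
(`exists_le_excessRisk_hypercube`).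

Gathering the free cells in a corner keeps `f` sparse. Its decomposition into maximal cells of
constancy has at most `2^d - 1` terms at each frequency from `1` to `i₀` and at most `2^(d(j-i₀))`
at each `j` with `i₀ < j ≤ J` (`hypercubeRule_mem_sparseClass`). The truncated class therefore
admits `i₀ = J - 1`, and the exponential class admits `i₀` close to `(1-α)J`. -/

/-! ### Indices of dyadic cells -/

/-- The index of the dyadic interval of frequency `j` containing `x`. -/
noncomputable def dyadicIndex (j : ℕ) (x : I) : Fin (2 ^ j) :=
  -- The minimum acts only at `x = 1`, where the floor is `2 ^ j`: the last interval is closed on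
  -- the right.
  ⟨min ⌊(x : ℝ) * 2 ^ j⌋₊ (2 ^ j - 1), by
    have : 0 < 2 ^ j := by positivity
    omega⟩

theorem mem_dyadicInterval_iff {j : ℕ} {x : I} {k : Fin (2 ^ j)} :
    x ∈ dyadicInterval j k ↔ dyadicIndex j x = k := by
  have hp : (0 : ℝ) < 2 ^ j := by positivity
  have hx0 : (0 : ℝ) ≤ x := x.2.1
  have hy0 : (0 : ℝ) ≤ x * 2 ^ j := by positivity
  have hk := k.2
  have h1 : ((k : ℝ) / 2 ^ j ≤ x) ↔ (k : ℕ) ≤ ⌊(x : ℝ) * 2 ^ j⌋₊ := by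
    rw [Nat.le_floor_iff hy0, div_le_iff₀ hp]
  have h2 : ((x : ℝ) < ((k : ℝ) + 1) / 2 ^ j) ↔ ⌊(x : ℝ) * 2 ^ j⌋₊ < (k : ℕ) + 1 := by
    rw [lt_div_iff₀ hp, Nat.floor_lt hy0]; push_cast; rfl
  have hfl : ⌊(x : ℝ) * 2 ^ j⌋₊ ≤ 2 ^ j := by
    refine Nat.floor_le_of_le ?_
    push_cast
    nlinarith [x.2.2]
  simp only [dyadicInterval, Set.mem_ofPred_eq, h1, h2, dyadicIndex, Fin.ext_iff]
  omega

/-- Nestedness of the partitions in arithmetic form: a coarser frequency drops the last `j' - j`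
binary digits. Division is monotone and sends `2 ^ j' - 1` to `2 ^ j - 1`, so it respects the
minimum. -/
theorem dyadicIndex_div {j j' : ℕ} (h : j ≤ j') (x : I) :
    (dyadicIndex j x : ℕ) = dyadicIndex j' x / 2 ^ (j' - j) := by
  obtain ⟨i, rfl⟩ := Nat.exists_eq_add_of_le h
  have hx0 : (0 : ℝ) ≤ x := x.2.1
  have hi : 0 < 2 ^ i := by positivity
  have hj : 0 < 2 ^ j := by positivity
  have hfl : ⌊(x : ℝ) * 2 ^ j⌋₊ = ⌊(x : ℝ) * 2 ^ (j + i)⌋₊ / 2 ^ i := by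
    rw [← Nat.floor_div_natCast]
    congr 1
    push_cast
    rw [pow_add]
    field_simp
  have hpred : (2 ^ (j + i) - 1) / 2 ^ i = 2 ^ j - 1 := by
    rw [pow_add, mul_comm]
    have := Nat.mul_sub_div 0 (2 ^ i) (2 ^ j) (by positivity)
    simpa using this
  have hmono : Monotone fun m : ℕ => m / 2 ^ i := fun _ _ h => Nat.div_le_div_right h
  simp only [dyadicIndex, Nat.add_sub_cancel_left]
  rw [hmono.map_min, hpred, hfl]

theorem exists_dyadicIndex_eq (j : ℕ) (k : Fin (2 ^ j)) :
    ∃ x : I, dyadicIndex j x = k := by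
  have hk : ((k : ℕ) : ℝ) ≤ 2 ^ j := by exact_mod_cast k.2.le
  have hp : (0 : ℝ) < 2 ^ j := by positivity
  refine ⟨⟨(k : ℝ) / 2 ^ j, by positivity, (div_le_one hp).2 hk⟩, ?_⟩
  rw [← mem_dyadicInterval_iff]
  refine ⟨le_rfl, Or.inl ?_⟩
  change (k : ℝ) / 2 ^ j < _
  gcongr
  linarith

/-- The index of the dyadic cell of frequency `j` containing `x`. -/
noncomputable def cellIndex {d : ℕ} (j : ℕ) (x : Cube d) : Fin d → Fin (2 ^ j) :=
  fun i => dyadicIndex j (x i)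

theorem mem_dyadicCell_iff {d j : ℕ} {x : Cube d} {k : Fin d → Fin (2 ^ j)} :
    x ∈ dyadicCell j k ↔ cellIndex j x = k := by
  simp [dyadicCell, mem_dyadicInterval_iff, funext_iff, cellIndex]

theorem mem_dyadicCell_cellIndex {d : ℕ} (j : ℕ) (x : Cube d) :
    x ∈ dyadicCell j (cellIndex j x) := mem_dyadicCell_iff.2 rfl

theorem dyadicCell_nonempty {d j : ℕ} (k : Fin d → Fin (2 ^ j)) : (dyadicCell j k).Nonempty := by
  choose x hx using fun i => exists_dyadicIndex_eq j (k i)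
  exact ⟨x, mem_dyadicCell_iff.2 (funext hx)⟩

theorem cellIndex_div {d j j' : ℕ} (h : j ≤ j') (x : Cube d) (i : Fin d) :
    (cellIndex j x i : ℕ) = cellIndex j' x i / 2 ^ (j' - j) :=
  dyadicIndex_div h (x i)

theorem cellIndex_eq_of_le {d j j' : ℕ} (h : j ≤ j') {x y : Cube d}
    (hxy : cellIndex j' x = cellIndex j' y) : cellIndex j x = cellIndex j y := by
  funext i
  apply Fin.ext
  rw [cellIndex_div h, cellIndex_div h, hxy]

theorem measurable_cellIndex {d : ℕ} (j : ℕ) : Measurable (cellIndex (d := d) j) := by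
  refine measurable_to_countable' fun k => ?_
  convert measurableSet_dyadicCell j k using 1
  ext x
  exact mem_dyadicCell_iff.symm

theorem volume_dyadicInterval (j : ℕ) (k : Fin (2 ^ j)) :
    volume (dyadicInterval j k) = ENNReal.ofReal ((2 ^ j)⁻¹ : ℝ) := by
  have hp : (0 : ℝ) < 2 ^ j := by positivity
  have hk : ((k : ℕ) : ℝ) + 1 ≤ 2 ^ j := by exact_mod_cast k.2
  have hlen : ((k : ℝ) + 1) / 2 ^ j - (k : ℝ) / 2 ^ j = (2 ^ j)⁻¹ := by field_simp; ring
  have h1 : ((k : ℝ) + 1) / 2 ^ j ≤ 1 := (div_le_one hp).2 hk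
  have h0 : 0 ≤ (k : ℝ) / 2 ^ j := by positivity
  rw [unitInterval.volume_apply, ← hlen]
  refine le_antisymm ?_ ?_
  · rw [← Real.volume_Icc]
    refine measure_mono ?_
    rintro _ ⟨x, ⟨hx1, hx2⟩, rfl⟩
    refine ⟨hx1, hx2.elim le_of_lt fun h => ?_⟩
    have : ((k : ℕ) : ℝ) + 1 = 2 ^ j := by
      have : 0 < 2 ^ j := by positivity
      have : (k : ℕ) + 1 = 2 ^ j := by omega
      exact_mod_cast this
    rw [this, div_self hp.ne']
    exact x.2.2
  · rw [← Real.volume_Ico]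
    refine measure_mono fun x hx => ?_
    exact ⟨⟨x, h0.trans hx.1, hx.2.le.trans h1⟩, ⟨hx.1, Or.inl hx.2⟩, rfl⟩

theorem volume_dyadicCell {d j : ℕ} (k : Fin d → Fin (2 ^ j)) :
    volume (dyadicCell j k) = ENNReal.ofReal ((2 ^ (d * j))⁻¹ : ℝ) := by
  have : dyadicCell j k = Set.pi Set.univ fun i => dyadicInterval j (k i) := by
    ext x; simp [dyadicCell]
  rw [this, volume_pi_pi]
  simp only [volume_dyadicInterval, Finset.prod_const, Finset.card_univ, Fintype.card_fin]
  rw [← ENNReal.ofReal_pow (by positivity), inv_pow, ← pow_mul, mul_comm]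

theorem volume_real_dyadicCell {d j : ℕ} (k : Fin d → Fin (2 ^ j)) :
    volume.real (dyadicCell j k) = ((2 ^ (d * j))⁻¹ : ℝ) := by
  rw [Measure.real, volume_dyadicCell, ENNReal.toReal_ofReal (by positivity)]

/-! ### Excess risk -/

section Risk

variable {d : ℕ} (π : ProbabilityMeasure (Cube d × Label))

instance : IsProbabilityMeasure (marginal π) := by
  unfold marginal; infer_instance

theorem measurable_eta : Measurable (eta π) := by
  unfold eta Measure.real
  exact (Kernel.measurable_coe _ (measurableSet_singleton _)).ennreal_toReal

theorem eta_nonneg (x : Cube d) : 0 ≤ eta π x := measureReal_nonneg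

theorem eta_le_one (x : Cube d) : eta π x ≤ 1 := measureReal_le_one

theorem measurable_bayesRule : Measurable (bayesRule π) := by
  classical
  unfold bayesRule
  refine Measurable.ite ?_ measurable_const measurable_const
  exact measurableSet_le measurable_const (((measurable_eta π).const_mul 2).sub_const 1)

theorem lintegral_condKernel (B : Set (Cube d)) (hB : MeasurableSet B) (y : Label) :
    ∫⁻ x in B, (π : Measure (Cube d × Label)).condKernel x {y} ∂(marginal π) =
      (π : Measure (Cube d × Label)) (B ×ˢ {y}) := by
  rw [marginal, Measure.setLIntegral_condKernel_eq_measure_prod hB (measurableSet_singleton y)]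

theorem integral_eta (B : Set (Cube d)) (hB : MeasurableSet B) :
    ∫ x in B, eta π x ∂(marginal π) = (π : Measure (Cube d × Label)).real (B ×ˢ {1}) := by
  rw [Measure.real, ← lintegral_condKernel π B hB 1]
  rw [← integral_toReal]
  · rfl
  · exact (Kernel.measurable_coe _ (measurableSet_singleton _)).aemeasurable
  · exact ae_of_all _ fun x => measure_lt_top _ _

theorem marginal_real_apply (B : Set (Cube d)) (hB : MeasurableSet B) :
    (marginal π).real B = (π : Measure (Cube d × Label)).real (B ×ˢ Set.univ) := by
  rw [marginal, Measure.real, Measure.fst_apply hB, Measure.real, Set.prod_univ]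

theorem marginal_real_eq_add (B : Set (Cube d)) (hB : MeasurableSet B) :
    (marginal π).real B = (π : Measure (Cube d × Label)).real (B ×ˢ {1}) +
      (π : Measure (Cube d × Label)).real (B ×ˢ {-1}) := by
  rw [marginal_real_apply π B hB, ← measureReal_union]
  · congr 1
    ext ⟨x, y⟩
    rcases Int.units_eq_one_or y with h | h <;> simp [h]
  · rw [Set.disjoint_left]
    rintro ⟨x, y⟩ ⟨_, h1⟩ ⟨_, h2⟩
    simp only [Set.mem_singleton_iff] at h1 h2
    rw [h1] at h2
    exact absurd h2 (by decide)
  · exact hB.prod (measurableSet_singleton _)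

theorem measurable_risk {n : ℕ} (f : Classifier d n) : Measurable fun D => risk π (f.toFun D) := by
  have hs : MeasurableSet {p : (Fin n → Cube d × Label) × (Cube d × Label) |
      f.toFun p.1 p.2.1 ≠ p.2.2} := by
    have h1 : Measurable fun p : (Fin n → Cube d × Label) × (Cube d × Label) =>
        f.toFun p.1 p.2.1 :=
      f.measurable'.comp (measurable_fst.prodMk (measurable_fst.comp measurable_snd))
    exact (measurableSet_eq_fun h1 (measurable_snd.comp measurable_snd)).compl
  exact (measurable_measure_prodMk_left
    (ν := (π : Measure (Cube d × Label))) hs).ennreal_toReal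

/-- An error of `f` which is not one of the Bayes rule occurs where the two rules differ. Only the
factor `|2η - 1| ≤ 1` is lost, and the margin keeps it above `h`. -/
theorem risk_sub_le (f : Cube d → Label) :
    risk π f - risk π (bayesRule π) ≤ (marginal π).real {x | f x ≠ bayesRule π x} := by
  rw [sub_le_iff_le_add, risk, risk]
  have h1 : (π : Measure (Cube d × Label)).real {z | f z.1 ≠ bayesRule π z.1} ≤
      (marginal π).real {x | f x ≠ bayesRule π x} := by
    refine ENNReal.toReal_mono (measure_ne_top _ _) ?_
    rw [marginal, Measure.fst]
    exact Measure.le_map_apply measurable_fst.aemeasurable _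
  refine (le_trans (measureReal_mono ?_) (measureReal_union_le _ _)).trans
    (add_le_add_left h1 _)
  intro z hz
  by_cases h : f z.1 = bayesRule π z.1
  · exact Or.inr (by simpa [h] using hz)
  · exact Or.inl h

theorem risk_mem_Icc (f : Cube d → Label) : risk π f ∈ Set.Icc (0 : ℝ) 1 :=
  ⟨measureReal_nonneg, measureReal_le_one⟩

theorem integrable_risk_sub {n : ℕ} (f : Classifier d n) (r : ℝ) (μ : Measure (Fin n → Cube d × Label))
    [IsFiniteMeasure μ] : Integrable (fun D => risk π (f.toFun D) - r) μ := by
  refine (Integrable.of_bound (measurable_risk π f).aestronglyMeasurable 1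
    (ae_of_all _ fun D => ?_)).sub (integrable_const r)
  rw [Real.norm_eq_abs, abs_le]
  have := risk_mem_Icc π (f.toFun D)
  exact ⟨by linarith [this.1], this.2⟩

end Risk

/-! ### Dyadic sums -/

theorem dyadicSum_eq_finsum {d : ℕ} (c : Coeffs d) (x : Cube d) :
    dyadicSum c x = ∑ᶠ j : ℕ, (c j (cellIndex j x) : ℤ) := by
  unfold dyadicSum
  refine finsum_congr fun j => ?_
  rw [Finset.sum_eq_single (cellIndex j x)]
  · rw [Set.indicator_of_mem (mem_dyadicCell_cellIndex j x)]
    simp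
  · intro k _ hk
    rw [Set.indicator_of_notMem (fun h => hk (mem_dyadicCell_iff.1 h).symm), mul_zero]
  · simp

/-- The cells containing `x` pairwise meet, so `zero_below` allows only one of them a non-zero
coefficient. -/
theorem WritingConvention.dyadicSum_eq {d : ℕ} {c : Coeffs d} (hc : WritingConvention c)
    {j : ℕ} {x : Cube d} (hj : c j (cellIndex j x) ≠ 0) :
    dyadicSum c x = c j (cellIndex j x) := by
  rw [dyadicSum_eq_finsum]
  refine finsum_eq_single _ j fun i hi => ?_
  have hmeet : ∀ i j, (dyadicCell i (cellIndex i x) ∩ dyadicCell j (cellIndex j x)).Nonempty :=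
    fun i j => ⟨x, mem_dyadicCell_cellIndex i x, mem_dyadicCell_cellIndex j x⟩
  have : c i (cellIndex i x) = 0 := by
    rcases lt_or_gt_of_ne hi with h | h
    · by_contra h0
      exact hj (hc.zero_below _ _ _ _ ⟨h, hmeet i j⟩ h0)
    · exact hc.zero_below _ _ _ _ ⟨h, hmeet j i⟩ hj
  rw [this]
  rfl

theorem exists_ne_zero_of_dyadicSum_ne_zero {d : ℕ} {c : Coeffs d} {x : Cube d}
    (h : dyadicSum c x ≠ 0) : ∃ j, c j (cellIndex j x) ≠ 0 := by
  by_contra! h0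
  apply h
  rw [dyadicSum_eq_finsum]
  simp [h0]

/-! ### Densities -/

instance {d : ℕ} : IsProbabilityMeasure (volume : Measure (Cube d)) :=
  inferInstanceAs (IsProbabilityMeasure (Measure.pi fun _ : Fin d => (volume : Measure I)))

section Density

variable {d : ℕ} {a A : ℝ} {P : Measure (Cube d)}

instance [IsFiniteMeasure P] : P.HaveLebesgueDecomposition volume :=
  Measure.haveLebesgueDecomposition_of_sigmaFinite _ _

theorem DensityAssumption.le_measureReal [IsFiniteMeasure P] (h : DensityAssumption a A P)
    (ha : 0 ≤ a) (B : Set (Cube d)) : a * volume.real B ≤ P.real B := by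
  have key : ENNReal.ofReal a * volume B ≤ P B := by
    rw [← Measure.setLIntegral_rnDeriv h.1, ← setLIntegral_const]
    exact lintegral_mono_ae (ae_restrict_of_ae (h.2.mono fun x hx => hx.1))
  have := ENNReal.toReal_mono (measure_ne_top P B) key
  rwa [ENNReal.toReal_mul, ENNReal.toReal_ofReal ha] at this

theorem DensityAssumption.measure_le [IsFiniteMeasure P] (h : DensityAssumption a A P)
    (B : Set (Cube d)) : P B ≤ ENNReal.ofReal A * volume B := by
  rw [← Measure.setLIntegral_rnDeriv h.1, ← setLIntegral_const]
  exact lintegral_mono_ae (ae_restrict_of_ae (h.2.mono fun x hx => hx.2))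

end Density

/-! ### Majority votes -/

section Majority

variable {d n : ℕ} (π : ProbabilityMeasure (Cube d × Label))

/-- The margin and the constant sign force `η > (1 + h) / 2` almost everywhere on `B`, or `η < (1 -
h) / 2` there; integrating `η` bounds the mass of the wrong label. -/
theorem measureReal_prod_neg_le {h : ℝ} (hπ : StrongMargin h π) {B : Set (Cube d)}
    (hB : MeasurableSet B) {s : Label} (hs : ∀ᵐ x ∂(marginal π), x ∈ B → bayesRule π x = s) :
    (π : Measure (Cube d × Label)).real (B ×ˢ {-s}) ≤ (1 - h) / 2 * (marginal π).real B := by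
  have hint : IntegrableOn (eta π) B (marginal π) :=
    (Integrable.of_bound (measurable_eta π).aestronglyMeasurable 1 (ae_of_all _ fun x => by
      rw [Real.norm_eq_abs, abs_of_nonneg (eta_nonneg π x)]
      exact eta_le_one π x)).integrableOn
  have hconst : ∀ r : ℝ, ∫ x in B, r ∂(marginal π) = r * (marginal π).real B := by
    intro r
    rw [setIntegral_const, smul_eq_mul, mul_comm]
  have hadd := marginal_real_eq_add π B hB
  have heta := integral_eta π B hB
  rcases Int.units_eq_one_or s with rfl | rfl
  · have : ∫ x in B, (1 + h) / 2 ∂(marginal π) ≤ ∫ x in B, eta π x ∂(marginal π) := by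
      refine setIntegral_mono_ae_restrict (integrable_const _) hint ?_
      refine (ae_restrict_iff' hB).2 ?_
      filter_upwards [hs, hπ] with x hx hm hxB
      have h1 := hx hxB
      unfold bayesRule at h1
      split_ifs at h1 with h2
      · rw [abs_of_nonneg h2] at hm
        linarith
      · exact absurd h1 (by decide)
    rw [hconst] at this
    linarith
  · have : ∫ x in B, eta π x ∂(marginal π) ≤ ∫ x in B, (1 - h) / 2 ∂(marginal π) := by
      refine setIntegral_mono_ae_restrict hint (integrable_const _) ?_
      refine (ae_restrict_iff' hB).2 ?_
      filter_upwards [hs, hπ] with x hx hm hxB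
      have h1 := hx hxB
      unfold bayesRule at h1
      split_ifs at h1 with h2
      · exact absurd h1 (by decide)
      · rw [abs_of_neg (not_le.1 h2)] at hm
        linarith
    rw [hconst] at this
    rw [neg_neg]
    linarith

open Classical in
/-- The exponential weight of an observation in the Chernoff bound for a majority vote in `B`. -/
noncomputable def voteWeight (B : Set (Cube d)) (s : Label) (r : ℝ) (z : Cube d × Label) : ℝ :=
  if z.1 ∈ B then (if z.2 = s then r else r⁻¹) else 1

theorem voteWeight_eq (B : Set (Cube d)) (s : Label) (r : ℝ) (z : Cube d × Label) :
    voteWeight B s r z = 1 + (B ×ˢ {s}).indicator (fun _ => r - 1) z +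
      (B ×ˢ {-s}).indicator (fun _ => r⁻¹ - 1) z := by
  classical
  obtain ⟨x, y⟩ := z
  have hne : s ≠ -s := by rcases Int.units_eq_one_or s with rfl | rfl <;> decide
  unfold voteWeight Set.indicator
  by_cases hx : x ∈ B
  · by_cases hy : y = s
    · subst hy; simp [hx, hne]
    · have : y = -s := by
        rcases Int.units_eq_one_or s with rfl | rfl <;>
          rcases Int.units_eq_one_or y with rfl | rfl <;> simp_all
      subst this; simp [hx, hne.symm]
  · simp [hx]

theorem integrable_voteWeight (B : Set (Cube d)) (hB : MeasurableSet B) (s : Label) (r : ℝ) :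
    Integrable (voteWeight B s r) (π : Measure (Cube d × Label)) := by
  have hm : ∀ y : Label, MeasurableSet (B ×ˢ ({y} : Set Label)) :=
    fun y => hB.prod (measurableSet_singleton _)
  rw [show voteWeight B s r = _ from funext (voteWeight_eq B s r)]
  exact ((integrable_const _).add ((integrable_const _).indicator (hm s))).add
    ((integrable_const _).indicator (hm (-s)))

/-- The mean is affine in the mass of the wrong label, with slope `h + ((1 - h)⁻¹ - 1) ≥ 0`. The
worst case is a wrong mass of `(1 - h) / 2` times that of `B`, where the stated value is attained.
-/
theorem integral_voteWeight_le {h : ℝ} (hh0 : 0 < h) (hh1 : h < 1) (hπ : StrongMargin h π)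
    {B : Set (Cube d)} (hB : MeasurableSet B) {s : Label}
    (hs : ∀ᵐ x ∂(marginal π), x ∈ B → bayesRule π x = s) :
    ∫ z, voteWeight B s (1 - h) z ∂(π : Measure (Cube d × Label)) ≤
      1 - h ^ 2 / 2 * (marginal π).real B := by
  have hm : ∀ y : Label, MeasurableSet (B ×ˢ ({y} : Set Label)) :=
    fun y => hB.prod (measurableSet_singleton _)
  have h1h : 0 < 1 - h := by linarith
  have hsum : (marginal π).real B = (π : Measure (Cube d × Label)).real (B ×ˢ {s}) +
      (π : Measure (Cube d × Label)).real (B ×ˢ {-s}) := by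
    rw [marginal_real_eq_add π B hB]
    rcases Int.units_eq_one_or s with rfl | rfl
    · rfl
    · rw [neg_neg, add_comm]
  have hle := measureReal_prod_neg_le π hπ hB hs
  simp_rw [voteWeight_eq]
  rw [integral_add ((integrable_const _).add ((integrable_const _).indicator (hm s)))
    ((integrable_const _).indicator (hm (-s))), integral_add (integrable_const _)
    ((integrable_const _).indicator (hm s)), integral_indicator_const _ (hm s),
    integral_indicator_const _ (hm (-s))]
  simp only [integral_const, probReal_univ, smul_eq_mul, mul_one]
  have hcoef : 0 ≤ h + ((1 - h)⁻¹ - 1) := by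
    have : 1 ≤ (1 - h)⁻¹ := (one_le_inv₀ h1h).2 (by linarith)
    linarith
  have := mul_le_mul_of_nonneg_right hle hcoef
  have e : (1 - h) / 2 * (marginal π).real B * (h + ((1 - h)⁻¹ - 1)) =
      (marginal π).real B * (h - h ^ 2 / 2) := by
    field_simp
    ring
  rw [e] at this
  have e2 : (π : Measure (Cube d × Label)).real (B ×ˢ {s}) =
    (marginal π).real B - (π : Measure (Cube d × Label)).real (B ×ˢ {-s}) := by linarith
  rw [e2]
  linarith

theorem prod_voteWeight (J : ℕ) (k : Fin d → Fin (2 ^ J)) (s : Label) (r : ℝ)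
    (D : Fin n → Cube d × Label) :
    ∏ i, voteWeight (dyadicCell J k) s r (D i) =
      r ^ cellCount J k s D * r⁻¹ ^ cellCount J k (-s) D := by
  classical
  have hne : s ≠ -s := by rcases Int.units_eq_one_or s with rfl | rfl <;> decide
  have : ∀ i, voteWeight (dyadicCell J k) s r (D i) =
      (if (D i).1 ∈ dyadicCell J k ∧ (D i).2 = s then r else 1) *
      (if (D i).1 ∈ dyadicCell J k ∧ (D i).2 = -s then r⁻¹ else 1) := by
    intro i
    unfold voteWeight
    by_cases hx : (D i).1 ∈ dyadicCell J k
    · by_cases hy : (D i).2 = s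
      · simp [hx, hy, hne]
      · have : (D i).2 = -s := by
          rcases Int.units_eq_one_or s with rfl | rfl <;>
            rcases Int.units_eq_one_or (D i).2 with h | h <;> simp_all
        simp [hx, this, hne.symm]
    · simp [hx]
  simp_rw [this]
  rw [Finset.prod_mul_distrib, Finset.prod_ite, Finset.prod_ite]
  simp [cellCount]

theorem cellCount_le_of_majorityCoeff_ne {J : ℕ} {k : Fin d → Fin (2 ^ J)} {s : Label}
    {D : Fin n → Cube d × Label} (h : majorityCoeff J D k ≠ s) :
    cellCount J k s D ≤ cellCount J k (-s) D := by
  unfold majorityCoeff at h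
  rcases Int.units_eq_one_or s with rfl | rfl
  · by_contra h2
    rw [if_pos (not_le.1 h2)] at h
    exact h rfl
  · by_contra h2
    rw [neg_neg] at h2
    rw [if_neg (by omega)] at h
    exact h rfl

theorem measurableSet_majorityCoeff_ne (J : ℕ) (k : Fin d → Fin (2 ^ J)) (s : Label) :
    MeasurableSet {D : Fin n → Cube d × Label | majorityCoeff J D k ≠ s} := by
  classical
  have : Measurable fun D : Fin n → Cube d × Label => majorityCoeff J D k := by
    unfold majorityCoeff
    exact Measurable.ite (measurableSet_lt (measurable_cellCount J k _) (measurable_cellCount J k _))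
      measurable_const measurable_const
  exact (measurableSet_eq_fun this measurable_const).compl

/-- Chernoff bound for the majority vote in a cell where the Bayes rule is constant. -/
theorem measureReal_majorityCoeff_ne_le {h : ℝ} (hh0 : 0 < h) (hh1 : h < 1)
    (hπ : StrongMargin h π) (J : ℕ) (k : Fin d → Fin (2 ^ J)) {s : Label}
    (hs : ∀ᵐ x ∂(marginal π), x ∈ dyadicCell J k → bayesRule π x = s) :
    (Measure.pi fun _ : Fin n => (π : Measure (Cube d × Label))).real
      {D | majorityCoeff J D k ≠ s} ≤
      Real.exp (-(h ^ 2 / 2 * (n * (marginal π).real (dyadicCell J k)))) := by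
  have h1h : 0 < 1 - h := by linarith
  have hB := measurableSet_dyadicCell (d := d) J k
  have hg0 : ∀ z, 0 ≤ voteWeight (dyadicCell J k) s (1 - h) z := by
    intro z
    unfold voteWeight
    split_ifs <;> positivity
  have hint : Integrable (fun D : Fin n → Cube d × Label =>
      ∏ i, voteWeight (dyadicCell J k) s (1 - h) (D i))
      (Measure.pi fun _ : Fin n => (π : Measure (Cube d × Label))) :=
    Integrable.fintype_prod fun _ => integrable_voteWeight π _ hB s _
  have hmarkov := mul_meas_ge_le_integral_of_nonneg
    (ae_of_all _ fun D => Finset.prod_nonneg fun i _ => hg0 (D i)) hint 1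
  rw [one_mul, integral_fintype_prod_eq_pow (ι := Fin n)
    (voteWeight (dyadicCell J k) s (1 - h))] at hmarkov
  refine (measureReal_mono fun D hD => ?_).trans (hmarkov.trans ?_)
  -- A wrong majority has at least as many wrong labels as right ones, ties included; as `1 - h ≤
  -- 1`, the product is at least `1` and Markov's inequality applies at level `1`.
  · change 1 ≤ ∏ i, voteWeight (dyadicCell J k) s (1 - h) (D i)
    rw [prod_voteWeight, inv_pow, ← div_eq_mul_inv, one_le_div (by positivity)]
    exact pow_le_pow_of_le_one h1h.le (by linarith) (cellCount_le_of_majorityCoeff_ne hD)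
  · have hle := integral_voteWeight_le π hh0 hh1 hπ hB hs
    have h0 : 0 ≤ ∫ z, voteWeight (dyadicCell J k) s (1 - h) z ∂(π : Measure (Cube d × Label)) :=
      integral_nonneg hg0
    have hexp := Real.one_sub_le_exp_neg (h ^ 2 / 2 * (marginal π).real (dyadicCell J k))
    rw [Fintype.card_fin]
    refine (pow_le_pow_left₀ h0 (hle.trans hexp) n).trans ?_
    rw [← Real.exp_nat_mul]
    apply le_of_eq
    congr 1
    ring

theorem majorityRule_eq (J : ℕ) (D : Fin n → Cube d × Label) (x : Cube d) :
    majorityRule J D x = majorityCoeff J D (cellIndex J x) := by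
  have : (∃ k, x ∈ dyadicCell J k ∧ majorityCoeff J D k = 1) ↔
      majorityCoeff J D (cellIndex J x) = 1 := by
    simp only [mem_dyadicCell_iff]
    exact ⟨fun ⟨k, hk, h⟩ => hk ▸ h, fun h => ⟨_, rfl, h⟩⟩
  unfold majorityRule
  split_ifs with h
  · exact (this.1 h).symm
  · exact ((Int.units_eq_one_or _).resolve_left fun h1 => h (this.2 h1)).symm

/-- The Bayes rule is almost surely constant on the cell of index `k`. -/
def BayesConstant (J : ℕ) (k : Fin d → Fin (2 ^ J)) : Prop :=
  ∃ s, ∀ᵐ x ∂(marginal π), x ∈ dyadicCell J k → bayesRule π x = s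

/-- Bad cells are charged their whole mass, and each good cell its mass times the Chernoff bound.
The masses sum to one, so the number of cells does not enter. -/
theorem excessRisk_majorityClassifier_le {h a A : ℝ} (hh0 : 0 < h) (hh1 : h < 1) (ha : 0 < a)
    (hP : DensityAssumption a A (marginal π)) (hπ : StrongMargin h π) (J : ℕ) :
    excessRisk π (majorityClassifier d n J) ≤
      (marginal π).real {x | ¬ BayesConstant π J (cellIndex J x)} +
        Real.exp (-(h ^ 2 / 2 * (n * (a * (2 ^ (d * J))⁻¹)))) := by
  classical
  set E := Real.exp (-(h ^ 2 / 2 * (n * (a * (2 ^ (d * J))⁻¹)))) with hE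
  set μ := Measure.pi fun _ : Fin n => (π : Measure (Cube d × Label)) with hμ
  set bad := {x : Cube d | ¬ BayesConstant π J (cellIndex J x)} with hbad
  have hchoice : ∀ k : Fin d → Fin (2 ^ J), ∃ s, BayesConstant π J k →
      ∀ᵐ x ∂(marginal π), x ∈ dyadicCell J k → bayesRule π x = s := by
    intro k
    by_cases hk : BayesConstant π J k
    · obtain ⟨s, hs⟩ := hk
      exact ⟨s, fun _ => hs⟩
    · exact ⟨1, fun h => absurd h hk⟩
  choose s hs using hchoice
  let good : Finset (Fin d → Fin (2 ^ J)) := Finset.univ.filter (BayesConstant π J)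
  let wrong : (Fin d → Fin (2 ^ J)) → Set (Fin n → Cube d × Label) :=
    fun k => {D | majorityCoeff J D k ≠ s k}
  have hwrong : ∀ k, MeasurableSet (wrong k) := fun k => measurableSet_majorityCoeff_ne J k _
  have hpoint : ∀ D : Fin n → Cube d × Label,
      risk π ((majorityClassifier d n J).toFun D) - risk π (bayesRule π) ≤
      (marginal π).real bad + ∑ k ∈ good,
        (wrong k).indicator (fun _ => (marginal π).real (dyadicCell J k)) D := by
    intro D
    refine (risk_sub_le π _).trans ?_
    have hsub : ({x | (majorityClassifier d n J).toFun D x ≠ bayesRule π x} : Set (Cube d))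
        ≤ᵐ[marginal π] (bad ∪ ⋃ k ∈ good.filter fun k => D ∈ wrong k, dyadicCell J k :
          Set (Cube d)) := by
      have hall : ∀ᵐ x ∂(marginal π), ∀ k, BayesConstant π J k →
          x ∈ dyadicCell J k → bayesRule π x = s k := by
        rw [ae_all_iff]
        intro k
        by_cases hk : BayesConstant π J k
        · filter_upwards [hs k hk] with x hx _ using hx
        · exact ae_of_all _ fun x h => absurd h hk
      filter_upwards [hall] with x hx hne
      by_cases hgood : BayesConstant π J (cellIndex J x)
      · right
        simp only [Set.mem_iUnion]
        refine ⟨cellIndex J x, ?_, mem_dyadicCell_cellIndex J x⟩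
        simp only [good, Finset.mem_filter, Finset.mem_univ, true_and]
        refine ⟨hgood, ?_⟩
        change majorityCoeff J D (cellIndex J x) ≠ _
        rw [← hx _ hgood (mem_dyadicCell_cellIndex J x), ← majorityRule_eq]
        exact hne
      · exact Or.inl hgood
    have h1 : (marginal π).real {x | (majorityClassifier d n J).toFun D x ≠ bayesRule π x} ≤
        (marginal π).real (bad ∪ ⋃ k ∈ good.filter fun k => D ∈ wrong k, dyadicCell J k) :=
      ENNReal.toReal_mono (measure_ne_top _ _) (measure_mono_ae hsub)
    refine h1.trans ((measureReal_union_le _ _).trans (add_le_add_right ?_ _))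
    refine (measureReal_biUnion_finset_le _ _).trans ?_
    rw [Finset.sum_filter]
    exact le_of_eq (Finset.sum_congr rfl fun k _ => by
      simp only [Set.indicator_apply])
  have hint : ∀ k ∈ good, Integrable
      ((wrong k).indicator fun _ => (marginal π).real (dyadicCell J k)) μ :=
    fun k _ => (integrable_const _).indicator (hwrong k)
  have hsum : ∑ k, (marginal π).real (dyadicCell J k) = 1 := by
    have := measureReal_biUnion_finset (μ := marginal π) (s := Finset.univ)
      (f := fun k : Fin d → Fin (2 ^ J) => dyadicCell J k) (fun k _ l _ hkl => by
        rw [Function.onFun, Set.disjoint_left]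
        intro x hx hx'
        exact hkl ((mem_dyadicCell_iff.1 hx).symm.trans (mem_dyadicCell_iff.1 hx')))
      (fun k _ => measurableSet_dyadicCell J k)
    rw [← this, ← probReal_univ (μ := marginal π)]
    congr 1
    ext x
    simp only [Set.mem_iUnion, Set.mem_univ, iff_true]
    exact ⟨cellIndex J x, Finset.mem_univ _, mem_dyadicCell_cellIndex J x⟩
  calc excessRisk π (majorityClassifier d n J)
      ≤ ∫ D, ((marginal π).real bad + ∑ k ∈ good,
        (wrong k).indicator (fun _ => (marginal π).real (dyadicCell J k)) D) ∂μ :=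
        integral_mono (integrable_risk_sub π _ _ _)
          ((integrable_const _).add (integrable_finsetSum _ hint)) hpoint
    _ = (marginal π).real bad + ∑ k ∈ good,
          μ.real (wrong k) * (marginal π).real (dyadicCell J k) := by
        rw [integral_add (integrable_const _) (integrable_finsetSum _ hint),
          integral_finsetSum _ hint]
        simp only [integral_const, probReal_univ, smul_eq_mul, one_mul]
        congr 1
        refine Finset.sum_congr rfl fun k _ => ?_
        rw [integral_indicator_const _ (hwrong k), smul_eq_mul]
    _ ≤ (marginal π).real bad + ∑ k, E * (marginal π).real (dyadicCell J k) := by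
        gcongr
        refine (Finset.sum_le_sum fun k hk => ?_).trans
          (Finset.sum_le_sum_of_subset_of_nonneg (Finset.subset_univ good)
            fun k _ _ => mul_nonneg (Real.exp_nonneg _) measureReal_nonneg)
        have hk' : BayesConstant π J k := (Finset.mem_filter.1 hk).2
        refine mul_le_mul_of_nonneg_right ?_ measureReal_nonneg
        refine (measureReal_majorityCoeff_ne_le π hh0 hh1 hπ J k (hs k hk')).trans ?_
        rw [hE, Real.exp_le_exp, neg_le_neg_iff, ← volume_real_dyadicCell k]
        have := hP.le_measureReal ha.le (dyadicCell J k)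
        gcongr
    _ = _ := by rw [← Finset.mul_sum, hsum, mul_one]

/-- The cells of frequency `J` on which a sparse Bayes rule is not constant have small mass. -/
theorem measureReal_not_bayesConstant_le {a A W α : ℝ} (hA : 0 ≤ A) (hW : 0 ≤ W) (hd : 1 ≤ d)
    (hα : α < 1) {w : ℕ → ℝ} (hw : ∀ j, w j ≤ W * (2 : ℝ) ^ ((d : ℝ) * α * j))
    (hP : DensityAssumption a A (marginal π)) (hf : bayesRule π ∈ sparseClass w (marginal π))
    (J : ℕ) :
    (marginal π).real {x | ¬ BayesConstant π J (cellIndex J x)} ≤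
      A * W * (1 - (2 : ℝ) ^ (-((d : ℝ) * (1 - α))))⁻¹ *
        ((2 ^ (d * J))⁻¹ : ℝ) ^ (1 - α) := by
  classical
  obtain ⟨c, hc, hcard, hae⟩ := hf
  -- Ratio of the geometric series: `2^(dαj)` cells of volume `2^(-dj)` have total volume `q^j`.
  set q : ℝ := (2 : ℝ) ^ (-((d : ℝ) * (1 - α))) with hq
  have hd' : (1 : ℝ) ≤ d := by exact_mod_cast hd
  have hq0 : 0 < q := by positivity
  have hq1 : q < 1 := Real.rpow_lt_one_of_one_lt_of_neg (by norm_num) (by nlinarith)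
  have hqj : ∀ j : ℕ, (2 : ℝ) ^ ((d : ℝ) * α * j) * (2 ^ (d * j))⁻¹ = q ^ j := by
    intro j
    rw [hq, ← Real.rpow_natCast 2 (d * j), ← Real.rpow_neg (by norm_num),
      ← Real.rpow_add (by norm_num), ← Real.rpow_mul_natCast (by norm_num)]
    congr 1
    push_cast
    ring
  have hqJ : ((2 ^ (d * J))⁻¹ : ℝ) ^ (1 - α) = q ^ J := by
    rw [hq, ← Real.rpow_natCast 2 (d * J), ← Real.rpow_neg (by norm_num),
      ← Real.rpow_mul (by norm_num), ← Real.rpow_mul_natCast (by norm_num)]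
    congr 1
    push_cast
    ring
  have hsub : ({x | ¬ BayesConstant π J (cellIndex J x)} : Set (Cube d)) ≤ᵐ[marginal π]
      (⋃ i : ℕ, ⋃ k ∈ Finset.univ.filter fun k => c (J + i) k ≠ 0, dyadicCell (J + i) k :
        Set (Cube d)) := by
    filter_upwards [hae] with x hx hbad
    obtain ⟨j, hj⟩ := exists_ne_zero_of_dyadicSum_ne_zero (c := c) (x := x)
      (by rw [← hx]; exact Units.ne_zero _)
    -- A non-zero coefficient at a frequency below `J` makes the Bayes rule almost surely constant
    -- on a cell containing the cell of `x`, which would then be good.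
    have hJj : J ≤ j := by
      by_contra! hlt
      refine hbad ⟨bayesRule π x, ?_⟩
      filter_upwards [hae] with y hy hyJ
      have e := cellIndex_eq_of_le hlt.le (mem_dyadicCell_iff.1 hyJ)
      rw [hc.dyadicSum_eq (by rwa [e]), e, ← hc.dyadicSum_eq hj, ← hx] at hy
      exact Units.ext hy
    obtain ⟨i, rfl⟩ := Nat.exists_eq_add_of_le hJj
    refine Set.mem_iUnion.2 ⟨i, Set.mem_iUnion₂.2 ?_⟩
    exact ⟨_, Finset.mem_filter.2 ⟨Finset.mem_univ _, hj⟩, mem_dyadicCell_cellIndex _ x⟩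
  have hlevel : ∀ j : ℕ, (marginal π) (⋃ k ∈ Finset.univ.filter fun k => c j k ≠ 0,
      dyadicCell j k) ≤ ENNReal.ofReal (A * W * q ^ j) := by
    intro j
    refine (measure_biUnion_finset_le _ _).trans ?_
    refine (Finset.sum_le_sum fun k _ => (hP.measure_le (dyadicCell j k)).trans_eq
      (by rw [volume_dyadicCell, ← ENNReal.ofReal_mul hA])).trans ?_
    rw [Finset.sum_const, ← ENNReal.ofReal_nsmul]
    refine ENNReal.ofReal_le_ofReal ?_
    have h1 := (hcard j).trans (hw j)
    rw [Nat.card_eq_fintype_card, Fintype.card_subtype] at h1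
    rw [nsmul_eq_mul, ← hqj]
    calc _ ≤ W * (2 : ℝ) ^ ((d : ℝ) * α * j) * (A * (2 ^ (d * j))⁻¹) := by gcongr
      _ = _ := by ring
  have hsummable : Summable fun i : ℕ => A * W * q ^ (J + i) := by
    simp_rw [pow_add]
    exact ((summable_geometric_of_lt_one hq0.le hq1).mul_left _).mul_left _
  have htsum : ∑' i : ℕ, A * W * q ^ (J + i) = A * W * (1 - q)⁻¹ * q ^ J := by
    simp_rw [pow_add]
    rw [tsum_mul_left, tsum_mul_left, tsum_geometric_of_lt_one hq0.le hq1]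
    ring
  rw [hqJ]
  have h1q : 0 < 1 - q := by linarith
  refine ENNReal.toReal_le_of_le_ofReal (by positivity) ?_
  refine (measure_mono_ae hsub).trans ((measure_iUnion_le _).trans ?_)
  rw [← htsum, ENNReal.ofReal_tsum_of_nonneg (fun i => by positivity) hsummable]
  exact ENNReal.tsum_le_tsum fun i => hlevel _

end Majority

/-! ### The rank of the majority-vote classifier -/

theorem log_natCast_pos {n : ℕ} (hn : 2 ≤ n) : 0 < Real.log n :=
  Real.log_pos (by exact_mod_cast hn)

theorem tendsto_referenceRank {d : ℕ} (hd : 1 ≤ d) {a : ℝ} (ha : 0 < a) :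
    Tendsto (fun n : ℕ => (referenceRank d a n : ℝ)) atTop atTop := by
  have hd' : (0 : ℝ) < d := by exact_mod_cast hd
  have hl2 : 0 < Real.log 2 := Real.log_pos (by norm_num)
  have h1 : Tendsto (fun x : ℝ => x / Real.log x) atTop atTop := by
    have h := Real.isLittleO_log_id_atTop
    have h0 : Tendsto (fun x : ℝ => Real.log x / x) atTop (nhdsWithin 0 (Set.Ioi 0)) := by
      refine tendsto_nhdsWithin_iff.2 ⟨h.tendsto_div_nhds_zero, ?_⟩
      filter_upwards [eventually_gt_atTop 1] with x hx
      exact div_pos (Real.log_pos hx) (by linarith)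
    refine (tendsto_inv_nhdsGT_zero.comp h0).congr fun x => ?_
    simp [inv_div]
  have h2 : Tendsto (fun n : ℕ => a * n / (2 ^ d * Real.log n)) atTop atTop := by
    refine ((h1.comp tendsto_natCast_atTop_atTop).const_mul_atTop
      (show 0 < a / 2 ^ d by positivity)).congr fun n => ?_
    simp only [Function.comp]
    rw [mul_div_mul_comm]
  have h3 : Tendsto (fun n : ℕ => Real.log (a * n / (2 ^ d * Real.log n)) / (d * Real.log 2))
      atTop atTop := (Real.tendsto_log_atTop.comp h2).atTop_div_const (by positivity)
  exact tendsto_atTop_mono (fun n => Int.le_ceil _) h3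

/-- For `n ≥ 2` the inequality `log n ≤ n` bounds the reference rank below by `b`, so truncation at
`0` costs a bounded amount, like the shift by `m`. As the rank tends to infinity, a bounded
difference yields equivalence. -/
theorem hasReferenceOrder_sub {d : ℕ} (hd : 1 ≤ d) {a : ℝ} (ha : 0 < a) (m : ℕ) :
    HasReferenceOrder d a fun n => (referenceRank d a n - m).toNat := by
  have hd' : (0 : ℝ) < d := by exact_mod_cast hd
  have hl2 : 0 < Real.log 2 := Real.log_pos (by norm_num)
  set b := Real.log (a / 2 ^ d) / (d * Real.log 2) with hb
  have hbound : ∀ n : ℕ, 2 ≤ n →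
      |((referenceRank d a n - m).toNat : ℝ) - referenceRank d a n| ≤ |b| + m := by
    intro n hn
    have hlog := log_natCast_pos hn
    have hbL : b ≤ referenceRank d a n := by
      refine le_trans ?_ (Int.le_ceil _)
      rw [hb]
      refine div_le_div_of_nonneg_right (Real.log_le_log (by positivity) ?_) (by positivity)
      rw [div_le_div_iff₀ (by positivity) (by positivity)]
      have : Real.log n ≤ n := Real.log_le_self (by positivity)
      have h2d : (0 : ℝ) < 2 ^ d := by positivity
      nlinarith [mul_le_mul_of_nonneg_left this (by positivity : 0 ≤ a * 2 ^ d)]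
    rcases le_or_gt (m : ℤ) (referenceRank d a n) with h | h
    · have e : (((referenceRank d a n - m).toNat : ℤ) : ℝ) = referenceRank d a n - m := by
        rw [Int.toNat_of_nonneg (by omega)]
        push_cast
        rfl
      rw [Int.cast_natCast] at e
      rw [e, abs_le]
      constructor <;> linarith [abs_nonneg b, (Nat.cast_nonneg m : (0 : ℝ) ≤ m)]
    · rw [Int.toNat_of_nonpos (by omega), Nat.cast_zero, zero_sub, abs_neg, abs_le]
      have h' : (referenceRank d a n : ℝ) ≤ m := by exact_mod_cast h.le
      constructor <;> linarith [neg_abs_le b, abs_nonneg b, (Nat.cast_nonneg m : (0 : ℝ) ≤ m)]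
  refine ⟨IsEquivalent.isTheta ?_, |b| + m, hbound⟩
  refine IsBigO.trans_isLittleO (g := fun _ => (1 : ℝ)) ?_ ?_
  · refine IsBigO.of_bound (|b| + m) ?_
    filter_upwards [eventually_ge_atTop 2] with n hn
    simpa using hbound n hn
  · exact (isLittleO_const_left.2 (Or.inr
      (tendsto_norm_atTop_atTop.comp (tendsto_referenceRank hd ha))))

/-- Lowering the reference rank by a fixed `m` with `κ 2^(dm) ≥ 1` brings the Chernoff exponent up
to `log n`, so the exponential is at most `1 / n`. The cell volume grows only by the factor
`2^(dm)`. -/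
theorem exists_rank {d : ℕ} (hd : 1 ≤ d) {a κ : ℝ} (ha : 0 < a) (hκ : 0 < κ) :
    ∃ J : ℕ → ℕ, HasReferenceOrder d a J ∧ ∃ C₁ C₂ : ℝ, 0 < C₁ ∧ 0 < C₂ ∧ ∀ n : ℕ, 2 ≤ n →
      ((2 ^ (d * J n))⁻¹ : ℝ) ≤ C₁ * (Real.log n / n) ∧
      Real.exp (-(κ * (n * (a * (2 ^ (d * J n))⁻¹)))) ≤ C₂ * (Real.log n / n) := by
  have hd' : (0 : ℝ) < d := by exact_mod_cast hd
  have hl2 : 0 < Real.log 2 := Real.log_pos (by norm_num)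
  obtain ⟨m, hm⟩ := pow_unbounded_of_one_lt κ⁻¹ (one_lt_two : (1 : ℝ) < 2)
  have hm' : 1 ≤ κ * 2 ^ (d * m) := by
    have : (2 : ℝ) ^ m ≤ 2 ^ (d * m) :=
      pow_le_pow_right₀ (by norm_num) (Nat.le_mul_of_pos_left m hd)
    rw [← mul_inv_cancel₀ hκ.ne']
    gcongr
    linarith
  refine ⟨_, hasReferenceOrder_sub hd ha m, 2 ^ (d * m) * (2 ^ d / a),
    (Real.log 2)⁻¹ + (κ * a * Real.log 2)⁻¹, by positivity, by positivity, fun n hn => ?_⟩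
  have hlog := log_natCast_pos hn
  have hn0 : (0 : ℝ) < n := by exact_mod_cast (by omega : 0 < n)
  have hlog2 : Real.log 2 ≤ Real.log n := Real.log_le_log (by norm_num) (by exact_mod_cast hn)
  set t := a * n / (2 ^ d * Real.log n) with ht
  have ht0 : 0 < t := by positivity
  have htexp : t = Real.exp (Real.log t) := (Real.exp_log ht0).symm
  set L := referenceRank d a n with hL
  have hpow : ∀ i : ℕ, (2 : ℝ) ^ (d * i) = Real.exp (d * i * Real.log 2) := by
    intro i
    rw [← Real.rpow_natCast, Real.rpow_def_of_pos (by norm_num)]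
    push_cast
    ring_nf
  have hLl : Real.log t ≤ L * (d * Real.log 2) := by
    rw [← div_le_iff₀ (by positivity)]
    exact Int.le_ceil _
  have hLu : (L - 1) * (d * Real.log 2) ≤ Real.log t := by
    rw [← le_div_iff₀ (by positivity)]
    have : (L : ℝ) < Real.log t / (d * Real.log 2) + 1 := Int.ceil_lt_add_one _
    linarith
  have htoNat : (L - m : ℝ) ≤ ((L - m).toNat : ℝ) := by exact_mod_cast Int.self_le_toNat (L - m)
  constructor
  · have e : (2 : ℝ) ^ (d * m) * (2 ^ d / a) * (Real.log n / n) = 2 ^ (d * m) * t⁻¹ := by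
      rw [ht]
      field_simp
    rw [e, hpow, hpow, ← Real.exp_neg]
    rw [htexp]
    rw [← Real.exp_neg, ← Real.exp_add, Real.exp_le_exp]
    nlinarith [mul_le_mul_of_nonneg_right htoNat (by positivity : 0 ≤ d * Real.log 2)]
  · have hbase : 1 / (n : ℝ) ≤ (Real.log 2)⁻¹ * (Real.log n / n) := by
      rw [← div_eq_inv_mul, div_right_comm]
      gcongr
      rwa [one_le_div hl2]
    rw [add_mul]
    have p1 : 0 ≤ (Real.log 2)⁻¹ * (Real.log n / n) := by positivity
    have p2 : 0 ≤ (κ * a * Real.log 2)⁻¹ * (Real.log n / n) := by positivity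
    rcases le_or_gt (m : ℤ) L with h | h
    · refine le_trans ?_ (hbase.trans (le_add_of_nonneg_right p2))
      have e : (((L - m).toNat : ℤ) : ℝ) = L - m := by
        rw [Int.toNat_of_nonneg (by omega)]
        push_cast
        rfl
      rw [Int.cast_natCast] at e
      -- The factor `2^d` in the definition of `t` absorbs the rounding up: `2^(dL) ≤ 2^d t = a n /
      -- log n`.
      have hle : (2 : ℝ) ^ (d * (L - m).toNat) * 2 ^ (d * m) ≤ a * n / Real.log n := by
        have e2 : a * n / Real.log n = 2 ^ (d * 1) * t := by
          rw [ht, mul_one]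
          field_simp
        rw [e2, hpow, hpow, hpow, e]
        rw [htexp, ← Real.exp_add, ← Real.exp_add, Real.exp_le_exp]
        push_cast
        linarith
      rw [one_div, ← Real.exp_log hn0, ← Real.exp_neg, Real.exp_le_exp, neg_le_neg_iff,
        Real.exp_log hn0]
      rw [le_div_iff₀ hlog] at hle
      set q : ℝ := 2 ^ (d * (L - m).toNat)
      have hq : 0 < q := by positivity
      rw [show κ * (n * (a * q⁻¹)) = κ * (a * n) / q by field_simp, le_div_iff₀ hq]
      calc Real.log n * q ≤ (κ * 2 ^ (d * m)) * (Real.log n * q) :=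
            le_mul_of_one_le_left (by positivity) hm'
        _ = κ * (q * 2 ^ (d * m) * Real.log n) := by ring
        _ ≤ κ * (a * n) := by gcongr
    -- Here the rank is truncated to `0` and the only cell is the cube; `exp(-x) ≤ 1 / x` suffices.
    · refine le_trans ?_ (le_add_of_nonneg_left p1)
      rw [Int.toNat_of_nonpos (by omega), mul_zero, pow_zero, inv_one, mul_one]
      have hx : 0 < κ * (n * a) := by positivity
      have : Real.exp (-(κ * (n * a))) ≤ (κ * (n * a))⁻¹ := by
        rw [Real.exp_neg]
        exact inv_anti₀ hx (by linarith [Real.add_one_le_exp (κ * (n * a))])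
      refine this.trans ?_
      rw [show (κ * (n * a))⁻¹ = (κ * a)⁻¹ * (1 / n) by field_simp, mul_inv _ (Real.log 2), mul_assoc]
      gcongr

/-- The mass of the bad cells dominates: since `log n ≤ n`, the vote error of order `log n / n` is
also of order `(log n / n)^(1-α)`. -/
theorem exists_rank_worstRisk_le {d : ℕ} (hd : 1 ≤ d) {h a A W α : ℝ} (hh0 : 0 < h) (hh1 : h < 1)
    (ha : 0 < a) (hA : 0 ≤ A) (hW : 0 ≤ W) (hα0 : 0 ≤ α) (hα1 : α < 1) {w : ℕ → ℝ}
    (hw : ∀ j, w j ≤ W * (2 : ℝ) ^ ((d : ℝ) * α * j)) :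
    ∃ J : ℕ → ℕ, HasReferenceOrder d a J ∧ ∃ C : ℝ, 0 < C ∧ ∀ n : ℕ, 2 ≤ n →
      worstRisk (model d w h a A) (majorityClassifier d n (J n)) ≤
        ((C * (Real.log n / n) ^ (1 - α) : ℝ) : EReal) := by
  have hd' : (1 : ℝ) ≤ d := by exact_mod_cast hd
  obtain ⟨J, hJ, C₁, C₂, hC₁, hC₂, hbound⟩ := exists_rank (κ := h ^ 2 / 2) hd ha (by positivity)
  set B := A * W * (1 - (2 : ℝ) ^ (-((d : ℝ) * (1 - α))))⁻¹ with hB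
  have hB0 : 0 ≤ B := by
    have : (2 : ℝ) ^ (-((d : ℝ) * (1 - α))) < 1 :=
      Real.rpow_lt_one_of_one_lt_of_neg (by norm_num) (by nlinarith)
    have : 0 < 1 - (2 : ℝ) ^ (-((d : ℝ) * (1 - α))) := by linarith
    positivity
  refine ⟨J, hJ, B * C₁ ^ (1 - α) + C₂, by positivity, fun n hn => ?_⟩
  refine iSup₂_le fun π hπ => EReal.coe_le_coe_iff.2 ?_
  obtain ⟨hP, hm, hf⟩ := hπ
  have hlog := log_natCast_pos hn
  have hn0 : (0 : ℝ) < n := by exact_mod_cast (by omega : 0 < n)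
  set x := Real.log n / n with hx
  have hx0 : 0 < x := by positivity
  have hx1 : x ≤ 1 := (div_le_one hn0).2 (Real.log_le_self hn0.le)
  have hxα : x ≤ x ^ (1 - α) := by
    nth_rewrite 1 [← Real.rpow_one x]
    exact Real.rpow_le_rpow_of_exponent_ge hx0 hx1 (by linarith)
  obtain ⟨h1, h2⟩ := hbound n hn
  calc excessRisk π (majorityClassifier d n (J n)) ≤ _ :=
        excessRisk_majorityClassifier_le π hh0 hh1 ha hP hm (J n)
    _ ≤ B * ((2 ^ (d * J n))⁻¹ : ℝ) ^ (1 - α) + C₂ * x :=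
        add_le_add (measureReal_not_bayesConstant_le π hA hW hd hα1 hw hP hf (J n)) h2
    _ ≤ B * (C₁ * x) ^ (1 - α) + C₂ * x ^ (1 - α) := by
        gcongr
    _ = _ := by
        rw [Real.mul_rpow hC₁.le hx0.le]
        ring

/-! ### Laws with uniform marginal and constant noise -/

section NoisyLaw

variable {d : ℕ}

/-- The joint law of a uniform `X` and of `Y`, equal to `f X` with probability `p` and to `-f X`
with probability `1 - p`. -/
noncomputable def noisyMeasure (f : Cube d → Label) (p : ℝ) : Measure (Cube d × Label) :=
  ENNReal.ofReal p • (volume : Measure (Cube d)).map (fun x => (x, f x)) +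
    ENNReal.ofReal (1 - p) • (volume : Measure (Cube d)).map (fun x => (x, -f x))

theorem measurable_neg_label {f : Cube d → Label} (hf : Measurable f) :
    Measurable fun x => -f x :=
  (Measurable.of_discrete (f := fun y : Label => -y)).comp hf

theorem noisyMeasure_apply {f : Cube d → Label} (hf : Measurable f) (p : ℝ)
    {S : Set (Cube d × Label)} (hS : MeasurableSet S) :
    noisyMeasure f p S = ENNReal.ofReal p * volume {x | (x, f x) ∈ S} +
      ENNReal.ofReal (1 - p) * volume {x | (x, -f x) ∈ S} := by
  rw [noisyMeasure, Measure.add_apply, Measure.smul_apply, Measure.smul_apply,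
    Measure.map_apply (measurable_id'.prodMk hf) hS,
    Measure.map_apply (measurable_id'.prodMk (measurable_neg_label hf)) hS]
  rfl

theorem noisyMeasure_prod_univ {f : Cube d → Label} (hf : Measurable f) {p : ℝ}
    (hp : p ∈ Set.Icc (0 : ℝ) 1) {B : Set (Cube d)} (hB : MeasurableSet B) :
    noisyMeasure f p (B ×ˢ Set.univ) = volume B := by
  rw [noisyMeasure_apply hf p (hB.prod MeasurableSet.univ)]
  simp only [Set.mem_prod, Set.mem_univ, and_true, Set.ofPred_mem_eq]
  rw [← add_mul, ← ENNReal.ofReal_add hp.1 (by linarith [hp.2])]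
  simp

theorem isProbabilityMeasure_noisyMeasure {f : Cube d → Label} (hf : Measurable f) {p : ℝ}
    (hp : p ∈ Set.Icc (0 : ℝ) 1) : IsProbabilityMeasure (noisyMeasure f p) :=
  ⟨by rw [← Set.univ_prod_univ, noisyMeasure_prod_univ hf hp MeasurableSet.univ, measure_univ]⟩

/-- `noisyMeasure` as a probability measure. -/
noncomputable def noisyLaw (f : Cube d → Label) (hf : Measurable f) (p : ℝ)
    (hp : p ∈ Set.Icc (0 : ℝ) 1) : ProbabilityMeasure (Cube d × Label) :=
  ⟨noisyMeasure f p, isProbabilityMeasure_noisyMeasure hf hp⟩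

variable {f : Cube d → Label} (hf : Measurable f) {p : ℝ} (hp : p ∈ Set.Icc (0 : ℝ) 1)

theorem noisyLaw_real_apply {S : Set (Cube d × Label)} (hS : MeasurableSet S) :
    (noisyLaw f hf p hp : Measure (Cube d × Label)).real S =
      p * volume.real {x | (x, f x) ∈ S} + (1 - p) * volume.real {x | (x, -f x) ∈ S} := by
  change (noisyMeasure f p S).toReal = _
  rw [noisyMeasure_apply hf p hS, ENNReal.toReal_add
    (ENNReal.mul_ne_top ENNReal.ofReal_ne_top (measure_ne_top _ _))
    (ENNReal.mul_ne_top ENNReal.ofReal_ne_top (measure_ne_top _ _)), ENNReal.toReal_mul,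
    ENNReal.toReal_mul, ENNReal.toReal_ofReal hp.1, ENNReal.toReal_ofReal (by linarith [hp.2])]
  rfl

theorem marginal_noisyLaw : marginal (noisyLaw f hf p hp) = volume := by
  refine Measure.ext fun B hB => ?_
  rw [marginal, Measure.fst_apply hB, ← Set.prod_univ]
  exact noisyMeasure_prod_univ hf hp hB

-- The conditional kernel is determined only almost everywhere, so `η` is identified by its
-- integrals over measurable sets.
open Classical in
theorem eta_noisyLaw :
    ∀ᵐ x ∂(volume : Measure (Cube d)), eta (noisyLaw f hf p hp) x = if f x = 1 then p else 1 - p := by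
  set π := noisyLaw f hf p hp with hπ
  have hm1 : MeasurableSet {x | f x = 1} := hf (measurableSet_singleton 1)
  have hmeas : Measurable fun x => if f x = 1 then p else 1 - p :=
    Measurable.ite hm1 measurable_const measurable_const
  have hi1 : Integrable (eta π) volume :=
    Integrable.of_bound (measurable_eta π).aestronglyMeasurable 1 (ae_of_all _ fun x => by
      rw [Real.norm_eq_abs, abs_of_nonneg (eta_nonneg π x)]
      exact eta_le_one π x)
  have hi2 : Integrable (fun x => if f x = 1 then p else 1 - p) (volume : Measure (Cube d)) :=
    Integrable.of_bound hmeas.aestronglyMeasurable 1 (ae_of_all _ fun x => by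
      rw [Real.norm_eq_abs, abs_le]
      have := hp.1
      have := hp.2
      split_ifs <;> constructor <;> linarith)
  refine Integrable.ae_eq_of_forall_setIntegral_eq _ _ hi1 hi2 fun B hB _ => ?_
  have h1 : ∫ x in B, eta π x = (π : Measure (Cube d × Label)).real (B ×ˢ {1}) := by
    rw [← integral_eta π B hB, marginal_noisyLaw]
  rw [h1, noisyLaw_real_apply hf hp (hB.prod (measurableSet_singleton _))]
  have h2 : (fun x => if f x = 1 then p else 1 - p) = fun x =>
      {x | f x = 1}.indicator (fun _ => p) x + {x | f x = 1}ᶜ.indicator (fun _ => 1 - p) x := by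
    funext x
    by_cases h : f x = 1 <;> simp [h]
  rw [h2, integral_add ((integrable_const _).indicator hm1)
    ((integrable_const _).indicator hm1.compl),
    integral_indicator_const _ hm1, integral_indicator_const _ hm1.compl, smul_eq_mul, smul_eq_mul,
    measureReal_restrict_apply hm1, measureReal_restrict_apply hm1.compl, mul_comm p,
    mul_comm (1 - p)]
  congr 3
  · ext x
    simp [and_comm]
  · ext x
    rcases Int.units_eq_one_or (f x) with h | h <;> simp [h]

theorem bayesRule_noisyLaw (hp2 : 1 / 2 < p) :
    ∀ᵐ x ∂(volume : Measure (Cube d)), bayesRule (noisyLaw f hf p hp) x = f x := by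
  filter_upwards [eta_noisyLaw hf hp] with x hx
  unfold bayesRule
  rw [hx]
  rcases Int.units_eq_one_or (f x) with h | h
  · rw [if_pos h, if_pos (by linarith), h]
  · have : f x ≠ 1 := by rw [h]; decide
    rw [if_neg this, if_neg (by linarith), h]

theorem strongMargin_noisyLaw {h : ℝ} (hp2 : h < 2 * p - 1) :
    StrongMargin h (noisyLaw f hf p hp) := by
  unfold StrongMargin
  rw [marginal_noisyLaw]
  filter_upwards [eta_noisyLaw hf hp] with x hx
  rw [hx]
  split_ifs
  · exact hp2.trans_le (le_abs_self _)
  · refine lt_of_lt_of_le ?_ (neg_le_abs _)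
    linarith

theorem densityAssumption_volume {a A : ℝ} (ha : a ≤ 1) (hA : 1 ≤ A) :
    DensityAssumption a A (volume : Measure (Cube d)) := by
  refine ⟨Measure.AbsolutelyContinuous.rfl, ?_⟩
  filter_upwards [Measure.rnDeriv_self (volume : Measure (Cube d))] with x hx
  rw [hx]
  exact ⟨ENNReal.ofReal_le_one.2 ha, ENNReal.one_le_ofReal.2 hA⟩

theorem risk_noisyLaw {g : Cube d → Label} (hg : Measurable g) :
    risk (noisyLaw f hf p hp) g = (1 - p) + (2 * p - 1) * volume.real {x | g x ≠ f x} := by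
  have hS : MeasurableSet {z : Cube d × Label | g z.1 ≠ z.2} :=
    (measurableSet_eq_fun (hg.comp measurable_fst) measurable_snd).compl
  have hS' : MeasurableSet {x | g x ≠ f x} := (measurableSet_eq_fun hg hf).compl
  rw [risk, noisyLaw_real_apply hf hp hS]
  have : {x | (x, -f x) ∈ {z : Cube d × Label | g z.1 ≠ z.2}} = {x | g x ≠ f x}ᶜ := by
    ext x
    rcases Int.units_eq_one_or (f x) with h | h <;>
      rcases Int.units_eq_one_or (g x) with h' | h' <;> simp [h, h']
  rw [this, measureReal_compl hS', probReal_univ]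
  change p * volume.real {x | g x ≠ f x} + _ = _
  ring

theorem risk_bayesRule_noisyLaw (hp2 : 1 / 2 < p) :
    risk (noisyLaw f hf p hp) (bayesRule (noisyLaw f hf p hp)) = 1 - p := by
  rw [risk_noisyLaw hf hp (measurable_bayesRule _)]
  have : volume.real {x | bayesRule (noisyLaw f hf p hp) x ≠ f x} = 0 := by
    rw [Measure.real, ae_iff.1 (bayesRule_noisyLaw hf hp hp2), ENNReal.toReal_zero]
  rw [this]
  ring

theorem Classifier.measurable_toFun {n : ℕ} (g : Classifier d n) (D : Fin n → Cube d × Label) :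
    Measurable (g.toFun D) :=
  g.measurable'.comp (measurable_const.prodMk measurable_id)

/-- Constant noise makes the excess risk exactly proportional to the volume of disagreement, which
is additive over cells. -/
theorem excessRisk_noisyLaw {n : ℕ} (hp2 : 1 / 2 < p) (g : Classifier d n) :
    excessRisk (noisyLaw f hf p hp) g = (2 * p - 1) * ∫ D, volume.real {x | g.toFun D x ≠ f x}
      ∂(Measure.pi fun _ : Fin n => (noisyLaw f hf p hp : Measure (Cube d × Label))) := by
  rw [excessRisk, ← integral_const_mul]
  congr 1
  funext D
  rw [risk_noisyLaw hf hp (g.measurable_toFun D), risk_bayesRule_noisyLaw hf hp hp2]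
  ring

theorem noisyLaw_restrict_congr {f' : Cube d → Label} (hf' : Measurable f') {B : Set (Cube d)}
    (hB : MeasurableSet B) (h : ∀ x ∉ B, f x = f' x) :
    (noisyLaw f hf p hp : Measure (Cube d × Label)).restrict (Bᶜ ×ˢ Set.univ) =
      (noisyLaw f' hf' p hp : Measure (Cube d × Label)).restrict (Bᶜ ×ˢ Set.univ) := by
  have hBc : MeasurableSet (Bᶜ ×ˢ (Set.univ : Set Label)) := hB.compl.prod MeasurableSet.univ
  refine Measure.ext fun S hS => ?_
  rw [Measure.restrict_apply hS, Measure.restrict_apply hS]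
  change noisyMeasure f p _ = noisyMeasure f' p _
  rw [noisyMeasure_apply hf p (hS.inter hBc), noisyMeasure_apply hf' p (hS.inter hBc)]
  congr 3
  · ext x
    by_cases hx : x ∈ B
    · simp [hx]
    · simp [h x hx]
  · ext x
    by_cases hx : x ∈ B
    · simp [hx]
    · simp [h x hx]

end NoisyLaw

/-! ### A minimax lower bound over hypercubes of rules -/

section Hypercube

variable {d n J : ℕ}

open Classical in
/-- The rule with label `τ k` on the cells of frequency `J` and index `k ∈ T`, and `-1`
elsewhere. -/
noncomputable def hypercubeRule (T : Finset (Fin d → Fin (2 ^ J)))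
    (τ : (Fin d → Fin (2 ^ J)) → Label) (x : Cube d) : Label :=
  if cellIndex J x ∈ T then τ (cellIndex J x) else -1

theorem measurable_hypercubeRule (T : Finset (Fin d → Fin (2 ^ J)))
    (τ : (Fin d → Fin (2 ^ J)) → Label) : Measurable (hypercubeRule T τ) := by
  classical
  exact (Measurable.of_discrete (f := fun k => if k ∈ T then τ k else -1)).comp
    (measurable_cellIndex J)

theorem measurable_measureReal_ne (B : Set (Cube d)) (hB : MeasurableSet B) (g : Classifier d n)
    {f : Cube d → Label} (hf : Measurable f) :
    Measurable fun D => volume.real (B ∩ {x | g.toFun D x ≠ f x}) := by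
  have hs : MeasurableSet {q : (Fin n → Cube d × Label) × Cube d |
      q.2 ∈ B ∧ g.toFun q.1 q.2 ≠ f q.2} :=
    (measurable_snd hB).inter (measurableSet_eq_fun g.measurable' (hf.comp measurable_snd)).compl
  exact (measurable_measure_prodMk_left (ν := (volume : Measure (Cube d))) hs).ennreal_toReal

theorem integrable_measureReal_ne (B : Set (Cube d)) (hB : MeasurableSet B) (g : Classifier d n)
    {f : Cube d → Label} (hf : Measurable f) (μ : Measure (Fin n → Cube d × Label))
    [IsFiniteMeasure μ] :
    Integrable (fun D => volume.real (B ∩ {x | g.toFun D x ≠ f x})) μ := by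
  refine Integrable.of_bound (measurable_measureReal_ne B hB g hf).aestronglyMeasurable 1
    (ae_of_all _ fun D => ?_)
  rw [Real.norm_eq_abs, abs_of_nonneg measureReal_nonneg]
  exact measureReal_le_one

/-- Two laws which only differ by opposite labels in a set `B` cannot be told apart without an
observation in `B`. -/
theorem two_point_lower_bound {f f' : Cube d → Label} (hf : Measurable f) (hf' : Measurable f')
    {p : ℝ} (hp : p ∈ Set.Icc (0 : ℝ) 1) {B : Set (Cube d)} (hB : MeasurableSet B)
    (hout : ∀ x ∉ B, f x = f' x) (hin : ∀ x ∈ B, f' x = -f x) (g : Classifier d n) :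
    volume.real B * (1 - volume.real B) ^ n ≤
      ∫ D, volume.real (B ∩ {x | g.toFun D x ≠ f x})
        ∂(Measure.pi fun _ : Fin n => (noisyLaw f hf p hp : Measure (Cube d × Label))) +
      ∫ D, volume.real (B ∩ {x | g.toFun D x ≠ f' x})
        ∂(Measure.pi fun _ : Fin n => (noisyLaw f' hf' p hp : Measure (Cube d × Label))) := by
  set μ := Measure.pi fun _ : Fin n => (noisyLaw f hf p hp : Measure (Cube d × Label)) with hμ
  set μ' := Measure.pi fun _ : Fin n => (noisyLaw f' hf' p hp : Measure (Cube d × Label)) with hμ'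
  -- The event that no observation falls in `B`; the two sample laws coincide on it.
  set E : Set (Fin n → Cube d × Label) := Set.pi Set.univ fun _ => Bᶜ ×ˢ Set.univ with hE
  have hrestrict : μ.restrict E = μ'.restrict E := by
    rw [hμ, hμ', hE, Measure.restrict_pi_pi, Measure.restrict_pi_pi]
    congr 1
    funext _
    exact noisyLaw_restrict_congr hf hp hf' hB hout
  have hμE : μ.real E = (1 - volume.real B) ^ n := by
    rw [hμ, hE, Measure.real, Measure.pi_pi, Finset.prod_const, Finset.card_univ,
      Fintype.card_fin, ENNReal.toReal_pow]
    congr 1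
    rw [← probReal_compl_eq_one_sub hB, ← marginal_noisyLaw hf hp,
      marginal_real_apply _ _ hB.compl]
    rfl
  -- The two rules are opposite on `B`, so each prediction there is wrong for exactly one of them.
  have hsplit : ∀ D, volume.real (B ∩ {x | g.toFun D x ≠ f x}) +
      volume.real (B ∩ {x | g.toFun D x ≠ f' x}) = volume.real B := by
    intro D
    have hm : MeasurableSet {x | g.toFun D x ≠ f x} :=
      (measurableSet_eq_fun (g.measurable_toFun D) hf).compl
    rw [← measureReal_inter_add_sdiff (s := B) hm]
    congr 2
    ext x
    simp only [Set.mem_inter_iff, Set.mem_sdiff, Set.mem_ofPred_eq]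
    refine and_congr_right fun hx => ?_
    rw [hin x hx]
    rcases Int.units_eq_one_or (f x) with h | h <;>
      rcases Int.units_eq_one_or (g.toFun D x) with h' | h' <;> simp [h, h']
  have hi := integrable_measureReal_ne B hB g hf μ
  have hi' := integrable_measureReal_ne B hB g hf' μ'
  have hi'' := integrable_measureReal_ne B hB g hf' μ
  calc volume.real B * (1 - volume.real B) ^ n
      = ∫ D in E, volume.real B ∂μ := by
        rw [setIntegral_const, smul_eq_mul, hμE, mul_comm]
    _ = ∫ D in E, (volume.real (B ∩ {x | g.toFun D x ≠ f x}) +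
          volume.real (B ∩ {x | g.toFun D x ≠ f' x})) ∂μ := by simp_rw [hsplit]
    _ = ∫ D in E, volume.real (B ∩ {x | g.toFun D x ≠ f x}) ∂μ +
          ∫ D in E, volume.real (B ∩ {x | g.toFun D x ≠ f' x}) ∂μ' := by
        rw [integral_add hi.integrableOn hi''.integrableOn, hrestrict]
    _ ≤ _ := add_le_add
        (setIntegral_le_integral hi (ae_of_all _ fun D => measureReal_nonneg))
        (setIntegral_le_integral hi' (ae_of_all _ fun D => measureReal_nonneg))

/-- Assouad's argument. For each `k ∈ T`, flipping the label of `k` is an involution pairing the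
labellings, and the two-point bound applies to each pair. Some labelling does at least as badly as
the average. -/
theorem exists_le_excessRisk_hypercube (T : Finset (Fin d → Fin (2 ^ J))) {p : ℝ}
    (hp : p ∈ Set.Icc (0 : ℝ) 1) (hp2 : 1 / 2 < p) (g : Classifier d n) :
    ∃ τ, (2 * p - 1) * (T.card * ((2 ^ (d * J))⁻¹ * (1 - (2 ^ (d * J))⁻¹) ^ n / 2)) ≤
      excessRisk (noisyLaw (hypercubeRule T τ) (measurable_hypercubeRule T τ) p hp) g := by
  classical
  set v : ℝ := (2 ^ (d * J))⁻¹ with hv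
  let G : ((Fin d → Fin (2 ^ J)) → Label) → (Fin d → Fin (2 ^ J)) → ℝ := fun τ k =>
    ∫ D, volume.real (dyadicCell J k ∩ {x | g.toFun D x ≠ hypercubeRule T τ x})
      ∂(Measure.pi fun _ : Fin n => (noisyLaw (hypercubeRule T τ) (measurable_hypercubeRule T τ) p
        hp : Measure (Cube d × Label)))
  have hexcess : ∀ τ, (2 * p - 1) * ∑ k ∈ T, G τ k ≤
      excessRisk (noisyLaw (hypercubeRule T τ) (measurable_hypercubeRule T τ) p hp) g := by
    intro τ
    have hfm := measurable_hypercubeRule T τ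
    rw [excessRisk_noisyLaw _ hp hp2]
    refine mul_le_mul_of_nonneg_left ?_ (by linarith)
    have hint := fun k => integrable_measureReal_ne (dyadicCell J k) (measurableSet_dyadicCell J k)
      g hfm (Measure.pi fun _ : Fin n => (noisyLaw _ hfm p hp : Measure (Cube d × Label)))
    rw [← integral_finsetSum _ fun k _ => hint k]
    have htot := integrable_measureReal_ne Set.univ MeasurableSet.univ
      g hfm (Measure.pi fun _ : Fin n => (noisyLaw _ hfm p hp : Measure (Cube d × Label)))
    simp only [Set.univ_inter] at htot
    refine integral_mono (integrable_finsetSum _ fun k _ => hint k) htot fun D => ?_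
    have hms : MeasurableSet {x | g.toFun D x ≠ hypercubeRule T τ x} :=
      (measurableSet_eq_fun (g.measurable_toFun D) hfm).compl
    change ∑ k ∈ T, volume.real (dyadicCell J k ∩ {x | g.toFun D x ≠ hypercubeRule T τ x}) ≤ _
    rw [← measureReal_biUnion_finset (fun k _ l _ hkl => by
        rw [Function.onFun, Set.disjoint_left]
        intro x hx hx'
        exact hkl ((mem_dyadicCell_iff.1 hx.1).symm.trans (mem_dyadicCell_iff.1 hx'.1)))
      (fun k _ => (measurableSet_dyadicCell J k).inter hms)]
    exact measureReal_mono (Set.iUnion₂_subset fun k _ => Set.inter_subset_right)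
  have hflip : ∀ k, Function.Involutive fun τ : (Fin d → Fin (2 ^ J)) → Label =>
      Function.update τ k (-τ k) := by
    intro k τ
    simp
  have hpair : ∀ k ∈ T, ∀ τ, v * (1 - v) ^ n ≤ G τ k + G (Function.update τ k (-τ k)) k := by
    intro k hk τ
    rw [hv, ← volume_real_dyadicCell k]
    refine two_point_lower_bound _ _ hp (measurableSet_dyadicCell J k) ?_ ?_ g
    · intro x hx
      rw [mem_dyadicCell_iff] at hx
      simp [hypercubeRule, Function.update_of_ne hx]
    · intro x hx
      rw [mem_dyadicCell_iff] at hx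
      simp [hypercubeRule, hx, hk]
  have hsumG : ∀ k ∈ T, ∑ _τ : (Fin d → Fin (2 ^ J)) → Label, v * (1 - v) ^ n / 2 ≤ ∑ τ, G τ k := by
    intro k hk
    have h1 := Equiv.sum_comp (hflip k).toPerm fun τ => G τ k
    have h2 := Finset.sum_le_sum fun τ (_ : τ ∈ Finset.univ) => hpair k hk τ
    rw [Finset.sum_add_distrib] at h2
    simp only [Function.Involutive.coe_toPerm] at h1
    rw [h1] at h2
    rw [← Finset.sum_div]
    linarith
  obtain ⟨τ, -, hτ⟩ := Finset.exists_le_of_sum_le (s := Finset.univ)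
    (f := fun _ : (Fin d → Fin (2 ^ J)) → Label =>
      (2 * p - 1) * (T.card * (v * (1 - v) ^ n / 2)))
    (g := fun τ => (2 * p - 1) * ∑ k ∈ T, G τ k) Finset.univ_nonempty (by
      have key : ∑ _τ : (Fin d → Fin (2 ^ J)) → Label, (T.card * (v * (1 - v) ^ n / 2) : ℝ) ≤
          ∑ τ, ∑ k ∈ T, G τ k := by
        rw [Finset.sum_comm]
        refine le_trans (le_of_eq ?_) (Finset.sum_le_sum hsumG)
        rw [Finset.sum_comm]
        simp
      have := mul_le_mul_of_nonneg_left key (by linarith : 0 ≤ 2 * p - 1)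
      rwa [Finset.mul_sum, Finset.mul_sum] at this)
  exact ⟨τ, hτ.trans (hexcess τ)⟩

end Hypercube

/-! ### The canonical dyadic decomposition of a rule -/

section Canonical

variable {d : ℕ} (f : Cube d → Label)

/-- The rule `f` is constant on the cell of frequency `j` containing `x`. -/
def ConstantAt (j : ℕ) (x : Cube d) : Prop := ∀ y, cellIndex j y = cellIndex j x → f y = f x

/-- The cell of frequency `j` containing `x` is the largest on which `f` is constant. -/
def MaximalAt (j : ℕ) (x : Cube d) : Prop := ConstantAt f j x ∧ ∀ i < j, ¬ ConstantAt f i x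

open Classical in
/-- The coefficients of `f` on its maximal cells of constancy. -/
noncomputable def canonicalCoeffs : Coeffs d := fun j k =>
  if MaximalAt f j (dyadicCell_nonempty k).some then
    (if f (dyadicCell_nonempty k).some = 1 then 1 else -1) else 0

variable {f}

theorem ConstantAt.mono {i j : ℕ} (hij : i ≤ j) {x : Cube d} (h : ConstantAt f i x) :
    ConstantAt f j x :=
  fun y hy => h y (cellIndex_eq_of_le hij hy)

theorem ConstantAt.congr {j : ℕ} {x y : Cube d} (hxy : cellIndex j x = cellIndex j y)
    (h : ConstantAt f j x) : ConstantAt f j y :=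
  fun z hz => (h z (hz.trans hxy.symm)).trans (h y hxy.symm).symm

theorem MaximalAt.congr {j : ℕ} {x y : Cube d} (hxy : cellIndex j x = cellIndex j y)
    (h : MaximalAt f j x) : MaximalAt f j y :=
  ⟨h.1.congr hxy, fun i hi hc => h.2 i hi (hc.congr (cellIndex_eq_of_le hi.le hxy).symm)⟩

open Classical in
theorem canonicalCoeffs_cellIndex (j : ℕ) (x : Cube d) :
    canonicalCoeffs f j (cellIndex j x) =
      if MaximalAt f j x then (if f x = 1 then 1 else -1) else 0 := by
  have hk := mem_dyadicCell_iff.1 (dyadicCell_nonempty (cellIndex j x)).some_mem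
  unfold canonicalCoeffs
  by_cases h : MaximalAt f j x
  · rw [if_pos h, if_pos (h.congr hk.symm), h.1 _ hk]
  · rw [if_neg h, if_neg fun h' => h (h'.congr hk)]

theorem canonicalCoeffs_ne_zero_iff {j : ℕ} {x : Cube d} :
    canonicalCoeffs f j (cellIndex j x) ≠ 0 ↔ MaximalAt f j x := by
  classical
  rw [canonicalCoeffs_cellIndex]
  split_ifs <;> simp_all

theorem MaximalAt.canonicalCoeffs_eq {j : ℕ} {x : Cube d} (h : MaximalAt f j x) :
    canonicalCoeffs f j (cellIndex j x) = if f x = 1 then 1 else -1 := by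
  classical
  rw [canonicalCoeffs_cellIndex, if_pos h]

theorem exists_maximalAt {J : ℕ} {x : Cube d} (h : ConstantAt f J x) : ∃ j, MaximalAt f j x := by
  classical
  have hex : ∃ j, ConstantAt f j x := ⟨J, h⟩
  exact ⟨Nat.find hex, Nat.find_spec hex, fun i hi => Nat.find_min hex hi⟩

theorem Below.exists_mem {j j' : ℕ} {k : Fin d → Fin (2 ^ j)} {k' : Fin d → Fin (2 ^ j')}
    (h : Below k k') : j < j' ∧ ∃ x, cellIndex j x = k ∧ cellIndex j' x = k' :=
  ⟨h.1, h.2.some, mem_dyadicCell_iff.1 h.2.some_mem.1, mem_dyadicCell_iff.1 h.2.some_mem.2⟩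

/-- A non-zero coefficient below a cell means that the rule is not constant on it, so both labels
occur. The maximal cells at points of either label are strictly finer, since otherwise the rule
would be constant on the given cell. -/
theorem writingConvention_canonicalCoeffs {J : ℕ} (hf : ∀ x, ConstantAt f J x) :
    WritingConvention (canonicalCoeffs f) := by
  constructor
  · intro j j' k k' hb hk
    obtain ⟨hlt, x, rfl, rfl⟩ := hb.exists_mem
    rw [canonicalCoeffs_ne_zero_iff] at hk
    by_contra h0
    exact (canonicalCoeffs_ne_zero_iff.1 h0).2 j hlt hk.1
  · rintro j k ⟨j', k', hb, hk'⟩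
    obtain ⟨hlt, x, rfl, rfl⟩ := hb.exists_mem
    have hnc : ¬ ConstantAt f j x := (canonicalCoeffs_ne_zero_iff.1 hk').2 j hlt
    have hbelow : ∀ z, cellIndex j z = cellIndex j x → ∃ (i : ℕ) (l : Fin d → Fin (2 ^ i)),
        Below (cellIndex j x) l ∧ canonicalCoeffs f i l = if f z = 1 then 1 else -1 := by
      intro z hz
      obtain ⟨i, hi⟩ := exists_maximalAt (hf z)
      refine ⟨i, cellIndex i z, ⟨?_, z, mem_dyadicCell_iff.2 hz, mem_dyadicCell_cellIndex i z⟩,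
        hi.canonicalCoeffs_eq⟩
      by_contra! hle
      exact hnc ((hi.1.mono hle).congr hz)
    obtain ⟨y, hy, hne⟩ : ∃ y, cellIndex j y = cellIndex j x ∧ f y ≠ f x := by
      unfold ConstantAt at hnc
      push Not at hnc
      exact hnc
    have hx := hbelow x rfl
    have hy := hbelow y hy
    rcases Int.units_eq_one_or (f x) with h | h <;>
      rcases Int.units_eq_one_or (f y) with h' | h' <;> rw [h] at hx hne <;> rw [h'] at hy hne
    · exact absurd rfl hne
    · exact ⟨by simpa using hx, by simpa using hy⟩
    · exact ⟨by simpa using hy, by simpa using hx⟩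
    · exact absurd rfl hne

theorem dyadicSum_canonicalCoeffs {J : ℕ} (hf : ∀ x, ConstantAt f J x) (x : Cube d) :
    dyadicSum (canonicalCoeffs f) x = (f x : ℤ) := by
  obtain ⟨j, hj⟩ := exists_maximalAt (hf x)
  rw [(writingConvention_canonicalCoeffs hf).dyadicSum_eq (canonicalCoeffs_ne_zero_iff.2 hj),
    hj.canonicalCoeffs_eq]
  rcases Int.units_eq_one_or (f x) with h | h <;> simp [h]

end Canonical

/-! ### Rules supported in a corner cell -/

section Corner

variable {d : ℕ}

/-- The indices of frequency `j` with all coordinates `< M`. -/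
def cornerIndices (d j M : ℕ) : Finset (Fin d → Fin (2 ^ j)) :=
  Fintype.piFinset fun _ => Finset.univ.filter fun l : Fin (2 ^ j) => (l : ℕ) < M

theorem mem_cornerIndices {j M : ℕ} {k : Fin d → Fin (2 ^ j)} :
    k ∈ cornerIndices d j M ↔ ∀ i, (k i : ℕ) < M := by
  simp [cornerIndices]

theorem card_cornerIndices {j M : ℕ} (h : M ≤ 2 ^ j) : (cornerIndices d j M).card = M ^ d := by
  rw [cornerIndices, Fintype.card_piFinset_const, Fin.card_filter_val_lt, min_eq_right h]

/-- The indices of frequency `J`, other than `0`, of cells in the corner cell of frequency `i₀`. -/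
def cornerSupport (d J i₀ : ℕ) : Finset (Fin d → Fin (2 ^ J)) :=
  (cornerIndices d J (2 ^ (J - i₀))).erase 0

theorem card_erase_zero_cornerIndices {j M : ℕ} (h : M ≤ 2 ^ j) (hM : 0 < M) :
    ((cornerIndices d j M).erase 0).card = M ^ d - 1 := by
  rw [Finset.card_erase_of_mem, card_cornerIndices h]
  rw [mem_cornerIndices]
  exact fun _ => hM

variable {J i₀ : ℕ} (τ : (Fin d → Fin (2 ^ J)) → Label)

theorem constantAt_hypercubeRule (T : Finset (Fin d → Fin (2 ^ J))) (x : Cube d) :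
    ConstantAt (hypercubeRule T τ) J x := by
  intro y hy
  rw [hypercubeRule, hypercubeRule, hy]

theorem hypercubeRule_eq_neg_one {T : Finset (Fin d → Fin (2 ^ J))} {x : Cube d}
    (h : cellIndex J x ∉ T) : hypercubeRule T τ x = -1 := by
  rw [hypercubeRule, if_neg h]

theorem cellIndex_val_lt_of_mem_cornerSupport {x : Cube d} (hi : i₀ ≤ J)
    (h : cellIndex J x ∈ cornerSupport d J i₀) {j : ℕ} (hj : j ≤ J) (i : Fin d) :
    (cellIndex j x i : ℕ) < 2 ^ (j - i₀) := by
  have h1 := mem_cornerIndices.1 (Finset.mem_of_mem_erase h) i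
  rw [cellIndex_div hj, Nat.div_lt_iff_lt_mul (by positivity), ← pow_add]
  refine h1.trans_le (Nat.pow_le_pow_right (by norm_num) ?_)
  omega

/-- By maximality the parent cell is not constant, hence contains the label `1`, which occurs only
on the support. All the counts below rest on this. -/
theorem exists_mem_cornerSupport_of_maximalAt {j : ℕ} {x : Cube d}
    (h : MaximalAt (hypercubeRule (cornerSupport d J i₀) τ) (j + 1) x) :
    ∃ z, cellIndex j z = cellIndex j x ∧ cellIndex J z ∈ cornerSupport d J i₀ ∧
      hypercubeRule (cornerSupport d J i₀) τ z = 1 := by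
  have hnc := h.2 j (Nat.lt_succ_self j)
  unfold ConstantAt at hnc
  push Not at hnc
  obtain ⟨y, hy, hne⟩ := hnc
  have hmem : ∀ z, hypercubeRule (cornerSupport d J i₀) τ z = 1 →
      cellIndex J z ∈ cornerSupport d J i₀ := by
    intro z hz
    by_contra h0
    rw [hypercubeRule_eq_neg_one τ h0] at hz
    exact absurd hz (by decide)
  rcases Int.units_eq_one_or (hypercubeRule (cornerSupport d J i₀) τ x) with h1 | h1
  · exact ⟨x, rfl, hmem x h1, h1⟩
  · have h2 := (Int.units_eq_one_or _).resolve_right (h1 ▸ hne)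
    exact ⟨y, hy, hmem y h2, h2⟩

theorem canonicalCoeffs_hypercubeRule_eq_zero {j : ℕ} (hj : J < j) (k : Fin d → Fin (2 ^ j)) :
    canonicalCoeffs (hypercubeRule (cornerSupport d J i₀) τ) j k = 0 := by
  obtain ⟨x, hx⟩ := dyadicCell_nonempty k
  rw [← mem_dyadicCell_iff.1 hx]
  by_contra h0
  exact (canonicalCoeffs_ne_zero_iff.1 h0).2 J hj (constantAt_hypercubeRule τ _ x)

/-- The parent has frequency at least `i₀` and meets the support, so it lies with its children in
the corner cell of frequency `i₀`. -/
theorem mem_cornerIndices_of_canonicalCoeffs_ne_zero (hi : i₀ ≤ J) {j : ℕ} (hj : i₀ < j)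
    (hjJ : j ≤ J) {k : Fin d → Fin (2 ^ j)}
    (hk : canonicalCoeffs (hypercubeRule (cornerSupport d J i₀) τ) j k ≠ 0) :
    k ∈ cornerIndices d j (2 ^ (j - i₀)) := by
  obtain ⟨x, hx⟩ := dyadicCell_nonempty k
  obtain ⟨j, rfl⟩ : ∃ i, j = i + 1 := ⟨j - 1, by omega⟩
  rw [← mem_dyadicCell_iff.1 hx] at hk ⊢
  rw [canonicalCoeffs_ne_zero_iff] at hk
  obtain ⟨z, hz, hzs, -⟩ := exists_mem_cornerSupport_of_maximalAt τ hk
  refine mem_cornerIndices.2 fun i => ?_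
  have h1 := cellIndex_val_lt_of_mem_cornerSupport hi hzs (by omega : j ≤ J) i
  rw [hz, cellIndex_div (Nat.le_succ j), Nat.div_lt_iff_lt_mul (by positivity), ← pow_add] at h1
  rwa [show j - i₀ + (j.succ - j) = j + 1 - i₀ by omega] at h1

/-- The parent is the corner cell of frequency `j - 1`, with `2^d` children. The corner child is
excluded: it contains a point labelled `1` and also the cell `0` of frequency `J`, labelled `-1`
because `cornerSupport` omits it. This saves the unit that appears in `expThreshold`. -/
theorem mem_erase_zero_of_canonicalCoeffs_ne_zero (hi : i₀ ≤ J) {j : ℕ} (hj0 : 1 ≤ j)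
    (hj : j ≤ i₀) {k : Fin d → Fin (2 ^ j)}
    (hk : canonicalCoeffs (hypercubeRule (cornerSupport d J i₀) τ) j k ≠ 0) :
    k ∈ (cornerIndices d j 2).erase 0 := by
  obtain ⟨x, hx⟩ := dyadicCell_nonempty k
  obtain ⟨j, rfl⟩ : ∃ i, j = i + 1 := ⟨j - 1, by omega⟩
  rw [← mem_dyadicCell_iff.1 hx] at hk ⊢
  rw [canonicalCoeffs_ne_zero_iff] at hk
  obtain ⟨z, hz, hzs, hz1⟩ := exists_mem_cornerSupport_of_maximalAt τ hk
  refine Finset.mem_erase.2 ⟨fun h0 => ?_, mem_cornerIndices.2 fun i => ?_⟩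
  · have hzx : cellIndex (j + 1) z = cellIndex (j + 1) x := by
      rw [h0]
      funext i
      have h1 := cellIndex_val_lt_of_mem_cornerSupport hi hzs (by omega : j + 1 ≤ J) i
      rw [Nat.sub_eq_zero_of_le hj, pow_zero, Nat.lt_one_iff] at h1
      exact Fin.ext (by simpa using h1)
    obtain ⟨o, ho⟩ := dyadicCell_nonempty (0 : Fin d → Fin (2 ^ J))
    rw [mem_dyadicCell_iff] at ho
    have hox : cellIndex (j + 1) o = cellIndex (j + 1) x := by
      rw [h0]
      funext i
      apply Fin.ext
      rw [cellIndex_div (by omega : j + 1 ≤ J), ho]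
      simp
    have e := (hk.1 z hzx).trans (hk.1 o hox).symm
    rw [hz1, hypercubeRule_eq_neg_one τ (by rw [ho]; simp [cornerSupport])] at e
    exact absurd e (by decide)
  · have h1 := cellIndex_val_lt_of_mem_cornerSupport hi hzs (by omega : j ≤ J) i
    rw [hz, cellIndex_div (Nat.le_succ j), Nat.div_lt_iff_lt_mul (by positivity), ← pow_add] at h1
    rwa [show j - i₀ + (j.succ - j) = 1 by omega, pow_one] at h1

theorem card_le_of_forall_mem {j : ℕ} {c : Coeffs d} {S : Finset (Fin d → Fin (2 ^ j))}
    (h : ∀ k, c j k ≠ 0 → k ∈ S) : Nat.card {k : Fin d → Fin (2 ^ j) // c j k ≠ 0} ≤ S.card := by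
  classical
  rw [Nat.card_eq_fintype_card, Fintype.card_subtype]
  exact Finset.card_le_card fun k hk => h k (Finset.mem_filter.1 hk).2

theorem hypercubeRule_mem_sparseClass {w : ℕ → ℝ} (hi : i₀ ≤ J) (hw : ∀ j, 0 ≤ w j)
    (hw0 : 1 ≤ w 0) (hw1 : ∀ j, 1 ≤ j → j ≤ i₀ → (2 : ℝ) ^ d - 1 ≤ w j)
    (hw2 : ∀ j, i₀ < j → j ≤ J → (2 : ℝ) ^ (d * (j - i₀)) ≤ w j) {f : Cube d → Label}
    {P : Measure (Cube d)}
    (hf : ∀ᵐ x ∂P, f x = hypercubeRule (cornerSupport d J i₀) τ x) : f ∈ sparseClass w P := by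
  have hconst := constantAt_hypercubeRule τ (cornerSupport d J i₀)
  refine ⟨_, writingConvention_canonicalCoeffs hconst, fun j => ?_, ?_⟩
  · rcases Nat.lt_or_ge J j with hJj | hjJ
    · have := card_le_of_forall_mem (S := ∅) fun k hk =>
        absurd (canonicalCoeffs_hypercubeRule_eq_zero (i₀ := i₀) τ hJj k) hk
      rw [Finset.card_empty, Nat.le_zero] at this
      rw [this, Nat.cast_zero]
      exact hw j
    rcases Nat.lt_or_ge i₀ j with h1 | h1
    · refine le_trans ?_ (hw2 j h1 hjJ)
      have := card_le_of_forall_mem fun k hk =>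
        mem_cornerIndices_of_canonicalCoeffs_ne_zero τ hi h1 hjJ hk
      rw [card_cornerIndices (Nat.pow_le_pow_right (by norm_num) (Nat.sub_le _ _)), ← pow_mul,
        mul_comm] at this
      exact_mod_cast this
    rcases Nat.eq_zero_or_pos j with rfl | h0
    · refine le_trans ?_ hw0
      simp
    · refine le_trans ?_ (hw1 j h0 h1)
      have := card_le_of_forall_mem fun k hk =>
        mem_erase_zero_of_canonicalCoeffs_ne_zero τ hi h0 h1 hk
      rw [card_erase_zero_cornerIndices (Nat.le_self_pow (by omega) 2) (by norm_num)] at this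
      have h2 : 1 ≤ 2 ^ d := Nat.one_le_two_pow
      rw [le_sub_iff_add_le]
      exact_mod_cast Nat.add_le_of_le_sub h2 this
  · filter_upwards [hf] with x hx
    rw [hx, dyadicSum_canonicalCoeffs hconst]

theorem le_minimaxExcessRisk {n : ℕ} {h a A : ℝ} (hh0 : 0 < h) (hh1 : h < 1) (ha1 : a ≤ 1)
    (hA : 1 ≤ A) (hd : 1 ≤ d) {w : ℕ → ℝ} (hi : i₀ < J) (hn : (2 * n : ℝ) ≤ 2 ^ (d * J))
    (hw : ∀ j, 0 ≤ w j) (hw0 : 1 ≤ w 0) (hw1 : ∀ j, 1 ≤ j → j ≤ i₀ → (2 : ℝ) ^ d - 1 ≤ w j)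
    (hw2 : ∀ j, i₀ < j → j ≤ J → (2 : ℝ) ^ (d * (j - i₀)) ≤ w j) :
    ((h / 8 * (2 ^ (d * i₀))⁻¹ : ℝ) : EReal) ≤ minimaxExcessRisk d n (model d w h a A) := by
  refine le_iInf fun g => ?_
  -- Then `2p - 1 = (1 + h) / 2` exceeds `h`, as the strict margin requires.
  set p := (3 + h) / 4 with hpdef
  have hp : p ∈ Set.Icc (0 : ℝ) 1 := ⟨by linarith, by linarith⟩
  have hp2 : 1 / 2 < p := by linarith
  obtain ⟨τ, hτ⟩ := exists_le_excessRisk_hypercube (cornerSupport d J i₀) hp hp2 g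
  set π := noisyLaw (hypercubeRule (cornerSupport d J i₀) τ)
    (measurable_hypercubeRule (cornerSupport d J i₀) τ) p hp with hπ
  have hmem : π ∈ model d w h a A := by
    refine ⟨?_, strongMargin_noisyLaw _ hp (by linarith), ?_⟩
    · rw [marginal_noisyLaw]
      exact densityAssumption_volume ha1 hA
    · rw [marginal_noisyLaw]
      exact hypercubeRule_mem_sparseClass τ hi.le hw hw0 hw1 hw2 (bayesRule_noisyLaw _ hp hp2)
  refine le_trans (EReal.coe_le_coe_iff.2 (le_trans ?_ hτ)) (le_iSup₂_of_le π hmem le_rfl)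
  set v : ℝ := (2 ^ (d * J))⁻¹ with hv
  have hv0 : 0 < v := by positivity
  have hvn : n * v ≤ 1 / 2 := by
    rw [hv, ← div_eq_mul_inv, div_le_div_iff₀ (by positivity) (by norm_num)]
    linarith
  have hv1 : v ≤ 1 := inv_le_one_of_one_le₀ (one_le_pow₀ (by norm_num))
  have hbern : 1 / 2 ≤ (1 - v) ^ n := by
    have := one_add_mul_le_pow (a := -v) (by linarith) n
    rw [← sub_eq_add_neg] at this
    linarith
  have hcard : (2 : ℝ) ^ (d * (J - i₀)) / 2 ≤ (cornerSupport d J i₀).card := by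
    have h1 := card_erase_zero_cornerIndices (d := d) (j := J) (M := 2 ^ (J - i₀))
      (Nat.pow_le_pow_right (by norm_num) (Nat.sub_le _ _)) (by positivity)
    rw [← pow_mul, mul_comm (J - i₀)] at h1
    have h2 : 2 ≤ 2 ^ (d * (J - i₀)) := Nat.le_self_pow
      (Nat.mul_ne_zero (by omega) (by omega)) 2
    have h3 : 2 ^ (d * (J - i₀)) ≤ 2 * (cornerSupport d J i₀).card := by
      rw [cornerSupport, h1]
      omega
    have h4 : (2 : ℝ) ^ (d * (J - i₀)) ≤ 2 * ((cornerSupport d J i₀).card : ℝ) := by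
      exact_mod_cast h3
    linarith
  have hcv : (2 ^ (d * i₀))⁻¹ / 2 ≤ (cornerSupport d J i₀).card * v := by
    refine le_trans (le_of_eq ?_) (mul_le_mul_of_nonneg_right hcard hv0.le)
    rw [hv, show d * J = d * (J - i₀) + d * i₀ by rw [← mul_add]; congr 1; omega, pow_add]
    field_simp
  set u : ℝ := (2 ^ (d * i₀))⁻¹
  have hu0 : 0 < u := by positivity
  -- Three halves make the `1/8`: the share of the corner filled by free cells, the probability of
  -- an unobserved cell, and the guess between two labels.
  calc h / 8 * u = h * (u / 2 * (1 / 2) / 2) := by ring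
    _ ≤ (2 * p - 1) * (((cornerSupport d J i₀).card * v) * (1 - v) ^ n / 2) := by
        gcongr
        all_goals linarith
    _ = _ := by ring

end Corner

/-! ### The truncated and the exponential classes -/

section Classes

variable {d : ℕ}

theorem exists_pow_lt_le (hd : 1 ≤ d) {n : ℕ} (hn : 1 ≤ n) :
    ∃ i : ℕ, (2 : ℝ) ^ (d * i) < 2 * n ∧ (2 * n : ℝ) ≤ 2 ^ (d * (i + 1)) := by
  classical
  have hn' : (1 : ℝ) ≤ n := by exact_mod_cast hn
  have hex : ∃ j : ℕ, (2 * n : ℝ) ≤ 2 ^ (d * j) := by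
    obtain ⟨j, hj⟩ := pow_unbounded_of_one_lt (2 * n : ℝ) (one_lt_two : (1 : ℝ) < 2)
    exact ⟨j, hj.le.trans (pow_le_pow_right₀ (by norm_num) (Nat.le_mul_of_pos_left j hd))⟩
  have h0 : Nat.find hex ≠ 0 := by
    intro h
    have := Nat.find_spec hex
    rw [h, mul_zero, pow_zero] at this
    linarith
  obtain ⟨i, hi⟩ := Nat.exists_eq_succ_of_ne_zero h0
  refine ⟨i, not_le.1 (Nat.find_min hex (by omega)), ?_⟩
  have := Nat.find_spec hex
  rwa [hi] at this

theorem truncatedWeight_le (K j : ℕ) : truncatedWeight d K j ≤ 2 ^ (d * K) := by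
  unfold truncatedWeight
  split_ifs with h
  · exact pow_le_pow_right₀ (by norm_num) (Nat.mul_le_mul_left d h)
  · exact le_rfl

theorem le_truncatedWeight {K j : ℕ} (hK : 1 ≤ K) (hj : 1 ≤ j) :
    2 ^ d ≤ truncatedWeight d K j := by
  unfold truncatedWeight
  split_ifs
  · exact pow_le_pow_right₀ (by norm_num) (Nat.le_mul_of_pos_right d hj)
  · exact pow_le_pow_right₀ (by norm_num) (Nat.le_mul_of_pos_right d hK)

theorem truncatedWeight_nonneg (K j : ℕ) : 0 ≤ truncatedWeight d K j := by
  unfold truncatedWeight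
  split_ifs <;> positivity

/-- With `J = i₀ + 1`, the only frequency beyond `i₀` is `J`, which needs `2^d` cells, within every
weight of positive frequency. As `2^(d i₀) < 2n`, the constant is free of `d` and `K`. -/
theorem le_minimaxExcessRisk_truncated {h a A : ℝ} (hh0 : 0 < h) (hh1 : h < 1) (ha1 : a ≤ 1)
    (hA : 1 ≤ A) {K : ℕ} (hK : 1 ≤ K) (hd : 1 ≤ d) {n : ℕ} (hn : 1 ≤ n) :
    ((h / 16 * (n : ℝ)⁻¹ : ℝ) : EReal) ≤
      minimaxExcessRisk d n (model d (truncatedWeight d K) h a A) := by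
  obtain ⟨i, hi, hi'⟩ := exists_pow_lt_le hd hn
  have hn' : (1 : ℝ) ≤ n := by exact_mod_cast hn
  refine le_trans (EReal.coe_le_coe_iff.2 ?_) (le_minimaxExcessRisk (J := i + 1) (i₀ := i) hh0 hh1
    ha1 hA hd (Nat.lt_succ_self i) hi' (truncatedWeight_nonneg K) ?_ ?_ ?_)
  · have : (2 * n : ℝ)⁻¹ ≤ (2 ^ (d * i))⁻¹ := inv_anti₀ (by positivity) hi.le
    rw [mul_inv] at this
    linarith [mul_le_mul_of_nonneg_left this (by positivity : 0 ≤ h / 8)]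
  · simp [truncatedWeight]
  · intro j hj _
    linarith [le_truncatedWeight (d := d) hK hj]
  · intro j hj hj'
    rw [show j - i = 1 by omega, mul_one]
    exact le_truncatedWeight hK (by omega)

theorem expThreshold_spec (hd : 1 ≤ d) {α : ℝ} (hα : 0 < α) :
    (2 : ℝ) ^ d - 1 ≤ (2 : ℝ) ^ ((d : ℝ) * α * expThreshold d α) := by
  have hd' : (1 : ℝ) ≤ d := by exact_mod_cast hd
  -- The infimum belongs to the set once the set is nonempty; any `N ≥ 1/α` will do.
  refine Nat.sInf_mem (s := {N : ℕ | (2 : ℝ) ^ d - 1 ≤ (2 : ℝ) ^ ((d : ℝ) * α * N)}) ?_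
  obtain ⟨N, hN⟩ := exists_nat_ge α⁻¹
  refine ⟨N, ?_⟩
  have h1 : 1 ≤ α * N := by
    rw [← mul_inv_cancel₀ hα.ne']
    gcongr
  have h2 : (2 : ℝ) ^ (d : ℝ) ≤ (2 : ℝ) ^ ((d : ℝ) * α * N) :=
    Real.rpow_le_rpow_of_exponent_le (by norm_num) (by nlinarith)
  rw [Real.rpow_natCast] at h2
  change (2 : ℝ) ^ d - 1 ≤ (2 : ℝ) ^ ((d : ℝ) * α * N)
  linarith

theorem expWeight_le {α : ℝ} (hα : 0 < α) (j : ℕ) :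
    expWeight d α j ≤ 2 ^ (d * expThreshold d α) * (2 : ℝ) ^ ((d : ℝ) * α * j) := by
  unfold expWeight
  split_ifs with h
  · refine (pow_le_pow_right₀ (by norm_num) (Nat.mul_le_mul_left d h)).trans
      (le_mul_of_one_le_right (by positivity) (Real.one_le_rpow (by norm_num) (by positivity)))
  · exact le_mul_of_one_le_left (by positivity) (one_le_pow₀ (by norm_num))

theorem expWeight_nonneg (α : ℝ) (j : ℕ) : 0 ≤ expWeight d α j := by
  unfold expWeight
  split_ifs <;> positivity

theorem sub_one_le_expWeight (hd : 1 ≤ d) {α : ℝ} (hα : 0 < α) {j : ℕ} (hj : 1 ≤ j) :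
    (2 : ℝ) ^ d - 1 ≤ expWeight d α j := by
  unfold expWeight
  split_ifs with h
  · have : (2 : ℝ) ^ d ≤ 2 ^ (d * j) :=
      pow_le_pow_right₀ (by norm_num) (Nat.le_mul_of_pos_right d hj)
    linarith
  · refine (expThreshold_spec hd hα).trans
      (Real.rpow_le_rpow_of_exponent_le (by norm_num) ?_)
    have : (expThreshold d α : ℝ) ≤ j := by exact_mod_cast (not_le.1 h).le
    gcongr

theorem pow_sub_le_expWeight {α : ℝ} {i j : ℕ} (hij : i ≤ j) (h : (1 - α) * j ≤ i) :
    (2 : ℝ) ^ (d * (j - i)) ≤ expWeight d α j := by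
  unfold expWeight
  split_ifs
  · exact pow_le_pow_right₀ (by norm_num) (Nat.mul_le_mul_left d (Nat.sub_le j i))
  · rw [← Real.rpow_natCast]
    refine Real.rpow_le_rpow_of_exponent_le (by norm_num) ?_
    push_cast [hij]
    rw [mul_assoc]
    gcongr
    linarith

theorem exists_le_minimaxExcessRisk_exp {h a A : ℝ} (hh0 : 0 < h) (hh1 : h < 1) (ha1 : a ≤ 1)
    (hA : 1 ≤ A) {α : ℝ} (hα0 : 0 < α) (hα1 : α < 1) (hd : 1 ≤ d) :
    ∃ C₀ : ℝ, 0 < C₀ ∧ ∀ n : ℕ, 1 ≤ n → ((C₀ * (n : ℝ) ^ (-1 + α) : ℝ) : EReal) ≤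
      minimaxExcessRisk d n (model d (expWeight d α) h a A) := by
  have hβ : 0 < 1 - α := by linarith
  -- These extra frequencies ensure `α J ≥ 1`, so that `i₀ < J` despite the rounding up of `(1 - α)
  -- J`.
  set R := ⌈α⁻¹⌉₊ with hR
  -- The first power of `2` pays for `R` and for the ceiling in `i₀`; the second comes from
  -- `2^(d(i+1)) ≤ 2^(d+1) n`.
  refine ⟨h / 8 * ((2 : ℝ) ^ (-((d : ℝ) * ((1 - α) * R + 1))) *
    ((2 : ℝ) ^ (d + 1)) ^ (-1 + α)), by positivity, fun n hn => ?_⟩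
  have hn' : (1 : ℝ) ≤ n := by exact_mod_cast hn
  obtain ⟨i, hi, hi'⟩ := exists_pow_lt_le hd hn
  set J := i + 1 + R with hJ
  -- The least corner frequency for which `j - i₀ ≤ α j` at every `j ≤ J`.
  set i₀ := ⌈(1 - α) * J⌉₊ with hi₀
  have hαJ : 1 ≤ α * J := by
    rw [← mul_inv_cancel₀ hα0.ne']
    have h1 : α⁻¹ ≤ R := Nat.le_ceil _
    have h2 : (R : ℝ) ≤ J := by exact_mod_cast Nat.le_add_left R (i + 1)
    gcongr
    exact h1.trans h2
  have hlt : i₀ < J := by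
    have hle : i₀ ≤ J - 1 := by
      rw [hi₀, Nat.ceil_le]
      push_cast [show 1 ≤ J by omega]
      linarith
    omega
  have hceil : (1 - α) * J ≤ i₀ := Nat.le_ceil _
  have hceil' : (i₀ : ℝ) ≤ (1 - α) * J + 1 := (Nat.ceil_lt_add_one (by positivity)).le
  refine le_trans (EReal.coe_le_coe_iff.2 ?_) (le_minimaxExcessRisk (J := J) (i₀ := i₀) hh0 hh1
    ha1 hA hd hlt (hi'.trans ?_) (expWeight_nonneg α) ?_ ?_ ?_)
  · rw [mul_assoc]
    refine mul_le_mul_of_nonneg_left ?_ (by positivity)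
    rw [mul_assoc, ← Real.mul_rpow (by positivity) (by positivity)]
    have hpow : ((2 : ℝ) ^ (d + 1) * n) ^ (-1 + α) ≤ ((2 : ℝ) ^ (d * (i + 1))) ^ (-1 + α) := by
      refine Real.rpow_le_rpow_of_nonpos (by positivity) ?_ (by linarith)
      rw [mul_add, mul_one, pow_add, pow_succ]
      nlinarith [mul_le_mul_of_nonneg_left hi.le (by positivity : (0 : ℝ) ≤ 2 ^ d)]
    refine (mul_le_mul_of_nonneg_left hpow (by positivity)).trans ?_
    rw [← Real.rpow_natCast 2 (d * (i + 1)), ← Real.rpow_mul (by norm_num),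
      ← Real.rpow_add (by norm_num), ← Real.rpow_natCast 2 (d * i₀), ← Real.rpow_neg (by norm_num)]
    refine Real.rpow_le_rpow_of_exponent_le (by norm_num) ?_
    have := mul_le_mul_of_nonneg_left hceil' (Nat.cast_nonneg d : (0 : ℝ) ≤ d)
    rw [hJ] at this
    push_cast at this ⊢
    linarith
  · exact pow_le_pow_right₀ (by norm_num) (Nat.mul_le_mul_left d (Nat.le_add_right _ _))
  · simp [expWeight]
  · exact fun j hj _ => sub_one_le_expWeight hd hα0 hj
  · intro j hj hjJ
    refine pow_sub_le_expWeight hj.le (le_trans ?_ hceil)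
    have : (j : ℝ) ≤ J := by exact_mod_cast hjJ
    gcongr

end Classes

end DyadicClassification

theorem mainTheorem1 (h a A : ℝ) (hh0 : 0 < h) (hh1 : h < 1) (ha0 : 0 < a) (ha1 : a ≤ 1)
    (hA : 1 ≤ A) :
    (∀ K : ℕ, 1 ≤ K →
      (∀ d : ℕ, 1 ≤ d → ∃ J : ℕ → ℕ, HasReferenceOrder d a J ∧
        ∃ C : ℝ, 0 < C ∧ ∀ n : ℕ, 2 ≤ n →
          worstRisk (model d (truncatedWeight d K) h a A) (majorityClassifier d n (J n)) ≤
            ((C * (Real.log n / n) : ℝ) : EReal)) ∧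
      (∃ C₀ : ℝ, 0 < C₀ ∧ ∀ d : ℕ, 1 ≤ d → ∀ n : ℕ, 1 ≤ n →
        ((C₀ * (n : ℝ)⁻¹ : ℝ) : EReal) ≤
          minimaxExcessRisk d n (model d (truncatedWeight d K) h a A))) ∧
    (∀ α : ℝ, 0 < α → α < 1 → ∀ d : ℕ, 1 ≤ d →
      (∃ J : ℕ → ℕ, HasReferenceOrder d a J ∧
        ∃ C : ℝ, 0 < C ∧ ∀ n : ℕ, 2 ≤ n →
          worstRisk (model d (expWeight d α) h a A) (majorityClassifier d n (J n)) ≤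
            ((C * (Real.log n / n) ^ (1 - α) : ℝ) : EReal)) ∧
      (∃ C₀ : ℝ, 0 < C₀ ∧ ∀ n : ℕ, 1 ≤ n →
        ((C₀ * (n : ℝ) ^ (-1 + α) : ℝ) : EReal) ≤
          minimaxExcessRisk d n (model d (expWeight d α) h a A))) := by
  refine ⟨fun K hK => ⟨fun d hd => ?_, h / 16, by positivity, fun d hd n hn =>
    le_minimaxExcessRisk_truncated hh0 hh1 ha1 hA hK hd hn⟩, fun α hα0 hα1 d hd =>
    ⟨exists_rank_worstRisk_le hd hh0 hh1 ha0 (by linarith) (by positivity) hα0.le hα1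
      (expWeight_le hα0), exists_le_minimaxExcessRisk_exp hh0 hh1 ha1 hA hα0 hα1 hd⟩⟩
  -- A bounded weight is the case `α = 0`, whose rate has exponent `1`.
  have := exists_rank_worstRisk_le (w := truncatedWeight d K) (W := 2 ^ (d * K)) (α := 0) (A := A)
    hd hh0 hh1 ha0 (by linarith) (by positivity) le_rfl one_pos fun j => by
      simpa using truncatedWeight_le K j
  simpa only [sub_zero, Real.rpow_one] using this
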